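/- Let $e$ be a positive integer and let $m\ge 4$ be an even integer with $\gcd(m,e)=1$. Put $q=2^m$ and let $$\mathcal C=\left\{\left(\mathrm{Tr}_{q/2}(\alpha x^{2^e+1}+\beta x+\gamma)\right)_{x\in \mathrm{GF}(q)} : \alpha,\beta,\gamma\in \mathrm{GF}(q)\right\},$$ a binary linear code of length $q$ whose coordinate positions are the elements of $\mathrm{GF}(q)$. Let $\mathcal C^\perp$ be its dual code. Let $T=\{x_1,x_2,x_3\}$ be a set of three distinct elements of $\mathrm{GF}(q)$, and let $\lambda=\lambda_{T,6}(\mathcal C^\perp)$ be the number of supports of codewords of Hamming weight $6$ in $\mathcal C^\perp$ that contain $T$. Put $a=\sum_{i=1}^3 x_i$ and $b=\sum_{i=1}^3 x_i^{2^e+1}$, and call an element of $\mathrm{GF}(q)$ a cubic residue if it is the cube of a nonzero element of $\mathrm{GF}(q)$. Then $$\lambda=\begin{cases}\frac16\left(q-2+(-1)^{m/2}2^{m/2}\right)-1 & \text{if } a^{2^e+1}+b \text{ is not a cubic residue},\\[2mm] \frac16\left(q-2-(-1)^{m/2}2^{m/2+1}\right)-1 & \text{if } a^{2^e+1}+b \text{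 is a cubic residue}.\end{cases}$$ Moreover, the shortened code $\mathcal C_T$ (take the codewords of $\mathcal C$ that are $0$ on $T$ and delete the coordinates in $T$) is a binary linear code of length $2^m-3$, dimension $2m-2$ and minimum distance $2^{m-1}-2^{m/2}$, and its weight distribution is $$\begin{array}{ll} \text{Weight} & \text{Multiplicity}\\ 0 & 1\\ 2^{m-1}-2^{m/2} & \frac13\cdot 2^{m/2-5}\left(8+2^{3+m/2}+2^{3m/2}+2^{2+m}+12\lambda\right)\\ 2^{m-1}-2^{(m-2)/2} & \frac13\cdot 2^{m/2-3}\left((2+2^{m/2})(-8+3\cdot 2^{m/2}+2^{1+m})-6\lambda\right)\\ 2^{m-1} & -1+4^{m-2}\\ 2^{m-1}+2^{(m-2)/2} & \frac13\cdot 2^{m/2-3}\left((-2+2^{m/2})(-8-3\cdot 2^{m/2}+2^{1+m})+6\lambda\right)\\ 2^{m-1}+2^{m/2} & \frac13\cdot 2^{m/2-5}\left(-8+2^{3+m/2}+2^{3m/2}-2^{2+m}-12\lambda\right) \end{array}$$ where every weight that is not listed has multiplicity $0$. -/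

import Mathlib

open Polynomial

noncomputable section

namespace ShortenedCode

variable {ι K F : Type*}

/-- The linear code over `K` with coordinate positions the elements of `F`, consisting of the
words `(Tr_{F/K}(a f(x) + b x + c))_{x ∈ F}` for `a, b, c ∈ F`. -/
def traceCode (K : Type*) {F : Type*} [Field K] [Field F] [Algebra K F] (f : F[X]) :
    Submodule K (F → K) where
  carrier := {w | ∃ a b c : F, w = fun x => Algebra.trace K F (a * f.eval x + b * x + c)}
  zero_mem' := ⟨0, 0, 0, by ext x; simp⟩
  add_mem' := by
    rintro _ _ ⟨a, b, c, rfl⟩ ⟨a', b', c', rfl⟩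
    refine ⟨a + a', b + b', c + c', ?_⟩
    ext x
    simp only [Pi.add_apply, ← map_add]
    congr 1
    ring
  smul_mem' := by
    rintro k _ ⟨a, b, c, rfl⟩
    refine ⟨k • a, k • b, k • c, ?_⟩
    ext x
    simp only [Pi.smul_apply, ← map_smul, smul_add, smul_mul_assoc]

/-- The dual code with respect to the standard inner product. -/
def dualCode [Fintype ι] [Field K] (C : Submodule K (ι → K)) : Submodule K (ι → K) where
  carrier := {w | ∀ c ∈ C, w ⬝ᵥ c = 0}
  zero_mem' := fun c _ => zero_dotProduct c
  add_mem' := fun hv hw c hc => by rw [add_dotProduct, hv c hc, hw c hc, add_zero]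
  smul_mem' := fun k _ hw c hc => by rw [smul_dotProduct, hw c hc, smul_zero]

/-- The subcode `C(T)` of the codewords of `C` that are zero on `T`. -/
def vanishingSubcode [Field K] (C : Submodule K (ι → K)) (T : Finset ι) :
    Submodule K (ι → K) where
  carrier := {c | c ∈ C ∧ ∀ i ∈ T, c i = 0}
  zero_mem' := ⟨C.zero_mem, fun _ _ => rfl⟩
  add_mem' := fun hv hw =>
    ⟨C.add_mem hv.1 hw.1, fun i hi => by rw [Pi.add_apply, hv.2 i hi, hw.2 i hi, add_zero]⟩
  smul_mem' := fun k _ hw =>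
    ⟨C.smul_mem k hw.1, fun i hi => by rw [Pi.smul_apply, hw.2 i hi, smul_zero]⟩

/-- The punctured code: the coordinates in `T` are deleted from all codewords of `C`. -/
def punctured [Field K] (C : Submodule K (ι → K)) (T : Finset ι) :
    Submodule K ({i // i ∉ T} → K) :=
  C.map (LinearMap.funLeft K K (Subtype.val : {i // i ∉ T} → ι))

/-- The shortened code `C_T`: the code `C(T)` punctured on `T`. -/
def shortened [Field K] (C : Submodule K (ι → K)) (T : Finset ι) :
    Submodule K ({i // i ∉ T} → K) :=
  punctured (vanishingSubcode C T) T

/-- `C` is an `[n, k, d]` code: length `n`, dimension `k`, minimum Hamming distance `d`. -/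
def IsLinearCode [Fintype ι] [Field K] [DecidableEq K] (C : Submodule K (ι → K))
    (n k d : ℕ) : Prop :=
  Fintype.card ι = n ∧ Module.finrank K C = k ∧
    IsLeast {j : ℕ | ∃ v ∈ C, ∃ w ∈ C, v ≠ w ∧ hammingDist v w = j} d

/-- `A_w(C)`: the number of codewords of Hamming weight `w`. -/
def weightCount [Fintype ι] [Field K] [DecidableEq K] (C : Submodule K (ι → K)) (w : ℕ) : ℕ :=
  Set.ncard {c : ι → K | c ∈ C ∧ hammingNorm c = w}

/-- The support of a word. -/
def supp [Fintype ι] [Field K] [DecidableEq K] (c : ι → K) : Finset ι :=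
  {i | c i ≠ 0}

/-- `B_w(C)`: the set of supports of the codewords of Hamming weight `w`. -/
def supports [Fintype ι] [Field K] [DecidableEq K] (C : Submodule K (ι → K)) (w : ℕ) :
    Set (Finset ι) :=
  {S | ∃ c ∈ C, hammingNorm c = w ∧ supp c = S}

/-- `λ_{T,w}(C)`: the number of supports of codewords of weight `w` that contain `T`. -/
def lam [Fintype ι] [Field K] [DecidableEq K] (C : Submodule K (ι → K))
    (T : Finset ι) (w : ℕ) : ℕ :=
  Set.ncard {S : Finset ι | S ∈ supports C w ∧ T ⊆ S}

/-- The weight distribution of `C` is the given table of rows (weight, multiplicity); the weights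
that are not listed do not occur. -/
def HasWeightDistribution [Fintype ι] [Field K] [DecidableEq K] (C : Submodule K (ι → K))
    (table : List (ℕ × ℚ)) : Prop :=
  (∀ r ∈ table, (weightCount C r.1 : ℚ) = r.2) ∧
    ∀ w : ℕ, (∀ r ∈ table, r.1 ≠ w) → weightCount C w = 0

/-- The weight table, for `m` even, with parameter `l`. The exponents `m / 2 - 5` and `m / 2 - 3`
may be negative and are integers. -/
def weightTable (m : ℕ) (l : ℚ) : List (ℕ × ℚ) :=
  [ (0, 1),
    (2 ^ (m - 1) - 2 ^ (m / 2),
      1 / 3 * 2 ^ ((m : ℤ) / 2 - 5) *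
        (8 + 2 ^ (3 + m / 2) + 2 ^ (3 * m / 2) + 2 ^ (2 + m) + 12 * l)),
    (2 ^ (m - 1) - 2 ^ ((m - 2) / 2),
      1 / 3 * 2 ^ ((m : ℤ) / 2 - 3) *
        ((2 + 2 ^ (m / 2)) * (-8 + 3 * 2 ^ (m / 2) + 2 ^ (1 + m)) - 6 * l)),
    (2 ^ (m - 1), -1 + 4 ^ (m - 2)),
    (2 ^ (m - 1) + 2 ^ ((m - 2) / 2),
      1 / 3 * 2 ^ ((m : ℤ) / 2 - 3) *
        ((-2 + 2 ^ (m / 2)) * (-8 - 3 * 2 ^ (m / 2) + 2 ^ (1 + m)) + 6 * l)),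
    (2 ^ (m - 1) + 2 ^ (m / 2),
      1 / 3 * 2 ^ ((m : ℤ) / 2 - 5) *
        (-8 + 2 ^ (3 + m / 2) + 2 ^ (3 * m / 2) - 2 ^ (2 + m) - 12 * l)) ]

/-- `x` is a cubic residue: the cube of an element of the multiplicative group. -/
def IsCubicResidue [Field F] (x : F) : Prop :=
  ∃ y : F, y ≠ 0 ∧ x = y ^ 3

end ShortenedCode

end

/-! Put `s = 2 ^ (m / 2)`. A word with parameters `p = (α, β, c)` has weight `(q - S) / 2`, where
its character sum `S` is, up to sign, the Walsh sum `walsh e α β`. By `walsh_sq`, for `α ≠ 0` the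
square of this sum is `q` times a character sum over the radical of the form `Tr (α * goldForm e u
v)`. Since `gcd (2 ^ e + 1) (q - 1) = 3`, that radical is trivial when `α` is not a cube and has
four elements when it is. Hence the nonzero words vanishing on `T` have `S` among `±s`, for `α` a
noncube, and `0`, `±2s` otherwise.

The five frequencies solve five linear equations. One counts the words with `α` a noncube
(`sumCount_add_sumCount_neg`). The others are the power moments of orders 0 to 3: by orthogonality
of characters, a moment of order `k` counts the ways to write a subset sum of the columns at `T` as
a sum of `k` columns (`four_mul_moment`). The only count that depends on the choice of `T` is that
of the triples with the same sum `a` and Gold power sum `b` as `T`.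

These triples also give `λ`. A weight-6 support containing `T` is `T` together with another triple
having the same two sums, and such triples are disjoint from `T` (`lam_add_one`). A shift by `a`
turns ordered triples into representations of `a ^ (2 ^ e + 1) + b` by `goldForm`, so there are `6 *
(λ + 1)` of them. This number is also `q - 2 + walsh e (a ^ (2 ^ e + 1) + b) 0` (`goldCount_eq`), a
Walsh sum whose absolute value is known and whose sign is fixed by its being `1` modulo `3`. -/

noncomputable section

namespace GoldCode

/-! ### The alternating form of the Gold function. -/

section Form

variable {F : Type*} [Field F]

/-- The polarisation of the Gold function `x ↦ x ^ (2 ^ e + 1)` in characteristic two. -/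
def goldForm (e : ℕ) (u v : F) : F := u ^ 2 ^ e * v + u * v ^ 2 ^ e

lemma goldForm_self [CharP F 2] (e : ℕ) (u : F) : goldForm e u u = 0 := by
  rw [goldForm, mul_comm u, CharTwo.add_self_eq_zero]

lemma goldForm_add_left [CharP F 2] (e : ℕ) (u u' v : F) :
    goldForm e (u + u') v = goldForm e u v + goldForm e u' v := by
  simp only [goldForm, add_pow_char_pow]
  ring

/-- This shift by `a` converts the Gold power condition on a triple of sum `a` into a representation
by the form. -/
lemma pow_add_pow_add_pow [CharP F 2] (e : ℕ) (a x y : F) :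
    x ^ (2 ^ e + 1) + y ^ (2 ^ e + 1) + (a + x + y) ^ (2 ^ e + 1) =
      a ^ (2 ^ e + 1) + goldForm e (x + a) (y + a) := by
  simp only [goldForm, pow_succ, add_pow_char_pow]
  linear_combination (x ^ 2 ^ e * x + y ^ 2 ^ e * y - a ^ 2 ^ e * a) * CharTwo.two_eq_zero (R := F)

lemma add_pow_succ [CharP F 2] (e : ℕ) (x w : F) :
    (x + w) ^ (2 ^ e + 1) = x ^ (2 ^ e + 1) + w ^ (2 ^ e + 1) + goldForm e x w := by
  simp only [goldForm, pow_succ, add_pow_char_pow]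
  ring

variable [Fintype F] {m e : ℕ}

/-- The order of a nonzero fixed point divides `gcd (2 ^ e - 1) (2 ^ m - 1) = 2 ^ gcd e m - 1 = 1`.
-/
lemma eq_zero_or_one_of_pow_eq_self (hF : Fintype.card F = 2 ^ m) (hme : m.Coprime e) {x : F}
    (h : x ^ 2 ^ e = x) : x = 0 ∨ x = 1 := by
  by_cases hx : x = 0
  · exact Or.inl hx
  right
  have h1 : x ^ (2 ^ e - 1) = 1 := by
    have : x ^ (2 ^ e - 1) * x = 1 * x := by
      rw [← pow_succ, Nat.sub_add_cancel Nat.one_le_two_pow, h, one_mul]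
    exact mul_right_cancel₀ hx this
  have h2 : x ^ (2 ^ m - 1) = 1 := by rw [← hF]; exact FiniteField.pow_card_sub_one_eq_one x hx
  have h3 := pow_gcd_eq_one.2 ⟨h1, h2⟩
  rwa [Nat.pow_sub_one_gcd_pow_sub_one, Nat.gcd_comm, hme.gcd_eq_one, pow_one, pow_one] at h3

lemma goldForm_eq_zero_iff [CharP F 2] (hF : Fintype.card F = 2 ^ m) (hme : m.Coprime e)
    {u v : F} : goldForm e u v = 0 ↔ u = 0 ∨ v = 0 ∨ u = v := by
  constructor
  · intro h
    by_cases hu : u = 0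
    · exact Or.inl hu
    by_cases hv : v = 0
    · exact Or.inr (Or.inl hv)
    right; right
    have h1 : (u / v) ^ 2 ^ e = u / v := by
      rw [goldForm, CharTwo.add_eq_zero] at h
      rw [div_pow, div_eq_div_iff (pow_ne_zero _ hv) hv, h]
    rcases eq_zero_or_one_of_pow_eq_self hF hme h1 with h2 | h2
    · exact absurd h2 (div_ne_zero hu hv)
    · exact (div_eq_one_iff_eq hv).1 h2
  · rintro (rfl | rfl | rfl)
    · simp [goldForm]
    · simp [goldForm]
    · exact goldForm_self e u

/-- An unordered pair of distinct elements is determined by its sum and the sum of its Gold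
powers. -/
lemma pair_eq_of_sums [CharP F 2] (hF : Fintype.card F = 2 ^ m) (hme : m.Coprime e)
    {s t x y : F} (hst : s ≠ t) (h1 : x + y = s + t)
    (h2 : x ^ (2 ^ e + 1) + y ^ (2 ^ e + 1) = s ^ (2 ^ e + 1) + t ^ (2 ^ e + 1)) :
    (x = s ∧ y = t) ∨ (x = t ∧ y = s) := by
  have hw : s + t ≠ 0 := fun h => hst (CharTwo.add_eq_zero.1 h)
  have two := CharTwo.two_eq_zero (R := F)
  have hy : y = x + (s + t) := by linear_combination h1 - x * two
  have ht : t = s + (s + t) := by linear_combination -s * two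
  -- Both pairs have difference `s + t`; comparing the Gold powers leaves only the polar terms.
  have h3 : goldForm e (x + s) (s + t) = 0 := by
    rw [goldForm_add_left]
    have e1 := add_pow_succ e x (s + t)
    have e2 := add_pow_succ e s (s + t)
    rw [← hy] at e1
    rw [← ht] at e2
    linear_combination h2 - e1 + e2 + (- x ^ (2 ^ e + 1) + s ^ (2 ^ e + 1) +
      goldForm e s (s + t)) * two
  rcases (goldForm_eq_zero_iff hF hme).1 h3 with h | h | h
  · have hx := CharTwo.add_eq_zero.1 h
    exact Or.inl ⟨hx, by rw [hy, hx]; exact ht.symm⟩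
  · exact absurd h hw
  · have hx : x = t := by linear_combination h
    exact Or.inr ⟨hx, by rw [hy, hx]; linear_combination t * two⟩

/-- The Gold power sum of three distinct elements is not the Gold power of their sum. -/
lemma pow_add_sum_ne_zero [CharP F 2] (hF : Fintype.card F = 2 ^ m) (hme : m.Coprime e)
    {r s t : F} (hrs : r ≠ s) (hrt : r ≠ t) (hst : s ≠ t) :
    (r + s + t) ^ (2 ^ e + 1) + (r ^ (2 ^ e + 1) + s ^ (2 ^ e + 1) + t ^ (2 ^ e + 1)) ≠ 0 := by
  intro h
  have two := CharTwo.two_eq_zero (R := F)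
  -- The two arguments of the form are `s + t` and `r + t`, so its vanishing would force two of `r`,
  -- `s`, `t` to coincide.
  have h1 := pow_add_pow_add_pow e (r + s + t) r s
  have h2 : r + s + t + r + s = t := by linear_combination (r + s) * two
  rw [h2] at h1
  have h3 : goldForm e (r + (r + s + t)) (s + (r + s + t)) = 0 := by
    linear_combination h - h1 + (-(r + s + t) ^ (2 ^ e + 1)) * two
  rcases (goldForm_eq_zero_iff hF hme).1 h3 with h | h | h
  · exact hst (by linear_combination h - (r + t) * two)
  · exact hrt (by linear_combination h - (s + t) * two)
  · exact hrs (by linear_combination h)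

end Form

/-! ### Cubes and Gold powers in the multiplicative group. -/

section Cubes

variable {F : Type*} [Field F] [Fintype F] {m e : ℕ}

/-- As `m` is even, `e` is odd, so `3` divides both numbers. Conversely the gcd divides `gcd (2 ^ (2
* e) - 1) (2 ^ m - 1) = 2 ^ 2 - 1`. -/
lemma gcd_two_pow_add_one (hm2 : Even m) (hme : m.Coprime e) :
    Nat.gcd (2 ^ e + 1) (2 ^ m - 1) = 3 := by
  have ho : Odd e := by
    rw [← Nat.not_even_iff_odd]
    intro h
    have := Nat.dvd_gcd hm2.two_dvd h.two_dvd
    rw [hme.gcd_eq_one] at this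
    omega
  have h3 : 3 ∣ 2 ^ e + 1 := by
    simpa using ho.nat_add_dvd_pow_add_pow 2 1
  have h3m : 3 ∣ 2 ^ m - 1 := by
    obtain ⟨k, rfl⟩ := hm2
    rw [← two_mul, pow_mul]
    simpa using Nat.sub_dvd_pow_sub_pow 4 1 k
  apply Nat.dvd_antisymm _ (Nat.dvd_gcd h3 h3m)
  have h1 : (2 ^ e + 1) ∣ 2 ^ (2 * e) - 1 := by
    refine ⟨2 ^ e - 1, ?_⟩
    have := Nat.sq_sub_sq (2 ^ e) 1
    rw [← this, one_pow, ← pow_mul, mul_comm]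
  have h2 := Nat.gcd_dvd_gcd_of_dvd_left (2 ^ m - 1) h1
  rw [Nat.pow_sub_one_gcd_pow_sub_one] at h2
  have h4 : Nat.gcd (2 * e) m = 2 := by
    rw [Nat.Coprime.gcd_mul_right_cancel 2 hme.symm]
    exact Nat.gcd_eq_left hm2.two_dvd
  rw [h4] at h2
  simpa using h2

lemma exists_cube_root_of_unity (hF : Fintype.card F = 2 ^ m) (hm2 : Even m) :
    ∃ w : F, w ^ 3 = 1 ∧ w ≠ 1 := by
  classical
  have h3m : 3 ∣ Fintype.card Fˣ := by
    rw [Fintype.card_units, hF]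
    obtain ⟨k, rfl⟩ := hm2
    rw [← two_mul, pow_mul]
    simpa using Nat.sub_dvd_pow_sub_pow 4 1 k
  have : Fact (Nat.Prime 3) := ⟨Nat.prime_three⟩
  obtain ⟨w, hw⟩ := exists_prime_orderOf_dvd_card 3 h3m
  refine ⟨w, ?_, ?_⟩
  · rw [← Units.val_pow_eq_pow_val, ← hw, pow_orderOf_eq_one, Units.val_one]
  · intro h
    rw [Units.val_eq_one] at h
    rw [h, orderOf_one] at hw
    omega

lemma cube_eq_cube_iff {K : Type*} [Field K] {w : K} (hw : w ^ 3 = 1) (hw1 : w ≠ 1) {y z : K} :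
    y ^ 3 = z ^ 3 ↔ y = z ∨ y = w * z ∨ y = w ^ 2 * z := by
  have hw2 : w ^ 2 + w + 1 = 0 := by
    have : (w - 1) * (w ^ 2 + w + 1) = 0 := by linear_combination hw
    exact (mul_eq_zero.1 this).resolve_left (sub_ne_zero.2 hw1)
  have key : y ^ 3 - z ^ 3 = (y - z) * ((y - w * z) * (y - w ^ 2 * z)) := by
    linear_combination (y ^ 2 * z - y * z ^ 2 * w) * hw2 + z ^ 3 * hw
  rw [← sub_eq_zero, key, mul_eq_zero, mul_eq_zero, sub_eq_zero, sub_eq_zero, sub_eq_zero]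

lemma card_filter_cube_eq [DecidableEq F] (hF : Fintype.card F = 2 ^ m) (hm2 : Even m) {z : F}
    (hz : z ≠ 0) : (Finset.univ.filter fun y : F => y ^ 3 = z ^ 3).card = 3 := by
  obtain ⟨w, hw, hw1⟩ := exists_cube_root_of_unity hF hm2
  have hw0 : w ≠ 0 := by rintro rfl; simp at hw
  rw [Finset.card_eq_three]
  refine ⟨z, w * z, w ^ 2 * z, ?_, ?_, ?_, ?_⟩
  · intro h; exact hw1 (mul_right_cancel₀ hz (by rw [one_mul]; exact h.symm))
  · intro h
    have h2 : w ^ 2 = 1 := mul_right_cancel₀ hz (by rw [one_mul]; exact h.symm)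
    exact hw1 (by linear_combination hw - w * h2)
  · intro h
    have h2 := mul_right_cancel₀ hz h
    exact hw1 (mul_left_cancel₀ hw0 (by linear_combination -h2))
  · ext y
    simp [cube_eq_cube_iff hw hw1]

/-- The nonzero cubes. -/
def cubes (F : Type*) [Field F] [Fintype F] [DecidableEq F] : Finset F :=
  (Finset.univ.filter fun z : F => z ≠ 0).image fun z => z ^ 3

lemma mem_cubes [DecidableEq F] {x : F} : x ∈ cubes F ↔ ShortenedCode.IsCubicResidue x := by
  simp [cubes, ShortenedCode.IsCubicResidue, eq_comm]

/-- Cubing is three-to-one on the nonzero elements. -/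
lemma sum_comp_cube [DecidableEq F] (hF : Fintype.card F = 2 ^ m) (hm2 : Even m) (h : F → ℤ) :
    ∑ z with z ≠ 0, h (z ^ 3) = 3 * ∑ w ∈ cubes F, h w := by
  rw [Finset.sum_comp h (fun z : F => z ^ 3), Finset.mul_sum]
  refine Finset.sum_congr rfl fun w hw => ?_
  rw [mem_cubes] at hw
  obtain ⟨z, hz, rfl⟩ := hw
  have : (Finset.filter (fun a : F => a ^ 3 = z ^ 3) {z | z ≠ 0}) =
      Finset.univ.filter fun y : F => y ^ 3 = z ^ 3 := by
    ext y
    simp only [Finset.mem_filter, Finset.mem_univ, true_and, and_iff_right_iff_imp]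
    rintro h rfl
    exact pow_ne_zero 3 hz (by rw [← h]; simp)
  rw [this, card_filter_cube_eq hF hm2 hz]
  simp

lemma three_mul_card_cubes [DecidableEq F] (hF : Fintype.card F = 2 ^ m) (hm2 : Even m) :
    3 * ((cubes F).card : ℤ) = 2 ^ m - 1 := by
  have h := sum_comp_cube (F := F) hF hm2 fun _ => 1
  have hc : (Finset.univ.filter fun z : F => z ≠ 0).card + 1 = 2 ^ m := by
    rw [Finset.filter_ne', Finset.card_erase_add_one (Finset.mem_univ _), Finset.card_univ, hF]
  simp only [Finset.sum_const, nsmul_eq_mul, mul_one] at h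
  have hc' : ((Finset.univ.filter fun z : F => z ≠ 0).card : ℤ) + 1 = 2 ^ m := by exact_mod_cast hc
  linarith

lemma pow_three_eq_iff_pow_eq (hF : Fintype.card F = 2 ^ m) (hm2 : Even m) (hme : m.Coprime e)
    {x y : F} (hx : x ≠ 0) (hy : y ≠ 0) :
    x ^ (2 ^ e + 1) = y ^ (2 ^ e + 1) ↔ x ^ 3 = y ^ 3 := by
  have hg := gcd_two_pow_add_one hm2 hme
  obtain ⟨k, hk⟩ : 3 ∣ 2 ^ e + 1 := hg ▸ Nat.gcd_dvd_left _ _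
  constructor
  · intro h
    have h1 : (x / y) ^ (2 ^ e + 1) = 1 := by
      rw [div_pow, h, div_self (pow_ne_zero _ hy)]
    have h2 : (x / y) ^ (2 ^ m - 1) = 1 := by
      rw [← hF]; exact FiniteField.pow_card_sub_one_eq_one _ (div_ne_zero hx hy)
    have h3 := pow_gcd_eq_one.2 ⟨h1, h2⟩
    rw [hg, div_pow] at h3
    exact (div_eq_one_iff_eq (pow_ne_zero _ hy)).1 h3
  · intro h
    rw [hk, pow_mul, h, ← pow_mul]

lemma isCubicResidue_iff_exists_mul_pow_eq_one (hF : Fintype.card F = 2 ^ m) (hm : m ≠ 0)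
    (hm2 : Even m)
    (hme : m.Coprime e) {x : F} :
    ShortenedCode.IsCubicResidue x ↔ ∃ y : F, x * y ^ (2 ^ e + 1) = 1 := by
  have hg := gcd_two_pow_add_one hm2 hme
  obtain ⟨k, hk⟩ : 3 ∣ 2 ^ e + 1 := hg ▸ Nat.gcd_dvd_left _ _
  constructor
  · rintro ⟨z, hz, rfl⟩
    have hpos : 2 ^ m - 1 ≠ 0 := by
      have := Nat.one_lt_two_pow hm
      omega
    -- Bézout writes `3` as a combination of `2 ^ e + 1` and `2 ^ m - 1`; the second exponent is
    -- trivial on units, so every cube is a Gold power.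
    have hbez := Nat.gcd_eq_gcd_ab (2 ^ e + 1) (2 ^ m - 1)
    rw [hg] at hbez
    have h2 : z ^ (2 ^ m - 1) = 1 := by rw [← hF]; exact FiniteField.pow_card_sub_one_eq_one z hz
    refine ⟨(z ^ (Nat.gcdA (2 ^ e + 1) (2 ^ m - 1)))⁻¹, ?_⟩
    have h3 : z ^ 3 = (z ^ (Nat.gcdA (2 ^ e + 1) (2 ^ m - 1))) ^ (2 ^ e + 1) := by
      rw [← zpow_natCast z 3, hbez, zpow_add₀ hz, zpow_mul z ((2 ^ m - 1 : ℕ) : ℤ), zpow_natCast, h2,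
        one_zpow, mul_one, mul_comm, zpow_mul, zpow_natCast]
    rw [inv_pow, ← h3, mul_inv_cancel₀ (pow_ne_zero _ hz)]
  · rintro ⟨y, hy⟩
    have hy0 : y ≠ 0 := by rintro rfl; simp at hy
    refine ⟨(y ^ k)⁻¹, inv_ne_zero (pow_ne_zero _ hy0), ?_⟩
    rw [hk, mul_comm 3 k, pow_mul] at hy
    rw [inv_pow]
    exact eq_inv_of_mul_eq_one_left hy

end Cubes

/-! ### The canonical additive character. -/

section Character

/-- The nontrivial additive character of the field with two elements. -/
def sgn : AddChar (ZMod 2) ℤ where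
  toFun z := if z = 0 then 1 else -1
  map_zero_eq_one' := by decide
  map_add_eq_mul' := by decide

lemma sgn_apply (z : ZMod 2) : sgn z = if z = 0 then 1 else -1 := rfl

lemma sgn_mul_self (z : ZMod 2) : sgn z * sgn z = 1 := by
  rw [sgn_apply]; split_ifs <;> rfl

lemma sum_sgn_mul (n : ZMod 2) : ∑ z : ZMod 2, sgn (z * n) = if n = 0 then 2 else 0 := by
  revert n; decide

variable {F : Type*} [Field F] [Algebra (ZMod 2) F]

/-- The canonical additive character of a finite field of characteristic two. -/
def traceChar (F : Type*) [Field F] [Algebra (ZMod 2) F] : AddChar F ℤ :=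
  sgn.compAddMonoidHom (Algebra.trace (ZMod 2) F).toAddMonoidHom

lemma traceChar_apply (x : F) : traceChar F x = sgn (Algebra.trace (ZMod 2) F x) := rfl

lemma traceChar_eq_one_or_neg_one (x : F) : traceChar F x = 1 ∨ traceChar F x = -1 := by
  rw [traceChar_apply, sgn_apply]; split_ifs <;> simp

variable [Fintype F]

lemma traceChar_isPrimitive : (traceChar F).IsPrimitive := by
  apply AddChar.IsPrimitive.of_ne_one
  intro h
  obtain ⟨x, hx⟩ := Algebra.trace_surjective (ZMod 2) F 1
  have h1 := DFunLike.congr_fun h x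
  rw [traceChar_apply, hx, AddChar.one_apply] at h1
  exact absurd h1 (by decide)

lemma sum_traceChar_mul [DecidableEq F] (b : F) :
    ∑ x : F, traceChar F (x * b) = if b = 0 then (Fintype.card F : ℤ) else 0 := by
  have := AddChar.sum_mulShift b (traceChar_isPrimitive (F := F))
  rw [this]; split_ifs <;> simp

lemma traceChar_sq (x : F) : traceChar F (x ^ 2) = traceChar F x := by
  rw [traceChar_apply, traceChar_apply]
  congr 1
  have h := Algebra.trace_eq_of_algEquiv (FiniteField.frobeniusAlgEquivOfAlgebraic (ZMod 2) F) x
  rw [← h]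
  simp [FiniteField.frobeniusAlgEquivOfAlgebraic]

lemma traceChar_pow_two_pow (x : F) (n : ℕ) : traceChar F (x ^ 2 ^ n) = traceChar F x := by
  induction n with
  | zero => simp
  | succ n ih => rw [pow_succ 2, pow_mul, traceChar_sq, ih]

end Character

/-! ### Walsh sums of the Gold function. -/

section Walsh

variable {F : Type*} [Field F] [Algebra (ZMod 2) F] [Fintype F] {m e : ℕ}

/-- The trace is Frobenius invariant, so the term in `v` may be raised to the power `2 ^ e`, after
which the whole is linear in `v ^ 2 ^ e`. -/
lemma mul_goldForm_identity [CharP F 2] (e : ℕ) (α u v : F) :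
    traceChar F (α * goldForm e u v) =
      traceChar F (v ^ 2 ^ e * (α * u + (α * u ^ 2 ^ e) ^ 2 ^ e)) := by
  have h : α * goldForm e u v = α * u ^ 2 ^ e * v + α * u * v ^ 2 ^ e := by
    rw [goldForm]; ring
  rw [h, AddChar.map_add_eq_mul, ← traceChar_pow_two_pow (α * u ^ 2 ^ e * v) e,
    ← AddChar.map_add_eq_mul]
  congr 1
  ring

/-- After multiplication by `u ^ 2 ^ e` the equation reads `y + y ^ 2 ^ e = 0` with `y = α * u ^ (2
^ e + 1)`, whose only nonzero solution is `y = 1`. -/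
lemma radical_iff {F : Type*} [Field F] [Fintype F] [CharP F 2] (hF : Fintype.card F = 2 ^ m) (hme : m.Coprime e) {α u : F}
    (hα : α ≠ 0) :
    α * u + (α * u ^ 2 ^ e) ^ 2 ^ e = 0 ↔ u = 0 ∨ α * u ^ (2 ^ e + 1) = 1 := by
  by_cases hu : u = 0
  · subst hu; simp
  have hp : u ^ 2 ^ e ≠ 0 := pow_ne_zero _ hu
  have key : (α * u + (α * u ^ 2 ^ e) ^ 2 ^ e) * u ^ 2 ^ e =
      α * u ^ (2 ^ e + 1) + (α * u ^ (2 ^ e + 1)) ^ 2 ^ e := by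
    rw [pow_succ u, ← mul_assoc α, mul_pow (α * u ^ 2 ^ e) u]; ring
  have h0 : α * u ^ (2 ^ e + 1) ≠ 0 := mul_ne_zero hα (pow_ne_zero _ hu)
  rw [← mul_eq_zero_iff_right hp, key, CharTwo.add_eq_zero]
  constructor
  · intro h
    exact Or.inr ((eq_zero_or_one_of_pow_eq_self hF hme h.symm).resolve_left h0)
  · rintro (h | h)
    · exact absurd h hu
    · rw [h, one_pow]

lemma sum_traceChar_goldForm [DecidableEq F] [CharP F 2] (hF : Fintype.card F = 2 ^ m)
    (hme : m.Coprime e) {α : F} (hα : α ≠ 0) (u : F) :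
    ∑ v : F, traceChar F (α * goldForm e u v) =
      if u = 0 ∨ α * u ^ (2 ^ e + 1) = 1 then (2 ^ m : ℤ) else 0 := by
  simp_rw [mul_goldForm_identity, ← radical_iff hF hme hα]
  have := (iterateFrobeniusEquiv F 2 e).toEquiv.sum_comp
    fun v => traceChar F (v * (α * u + (α * u ^ 2 ^ e) ^ 2 ^ e))
  rw [sum_traceChar_mul, hF] at this
  simpa [iterateFrobenius_def] using this

/-- The Walsh transform of the Gold function. -/
def walsh (e : ℕ) (α β : F) : ℤ := ∑ x : F, traceChar F (α * x ^ (2 ^ e + 1) + β * x)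

/-- Square the sum and substitute `y = x + u`: the inner sum over `x` involves only the polar form
and vanishes unless `u` lies in the radical. -/
lemma walsh_sq [DecidableEq F] [CharP F 2] (hF : Fintype.card F = 2 ^ m) (hme : m.Coprime e)
    {α : F} (hα : α ≠ 0) (β : F) :
    walsh e α β ^ 2 = 2 ^ m * ∑ u with u = 0 ∨ α * u ^ (2 ^ e + 1) = 1,
      traceChar F (α * u ^ (2 ^ e + 1) + β * u) := by
  have h1 : walsh e α β ^ 2 = ∑ u : F, ∑ x : F,
      traceChar F (α * x ^ (2 ^ e + 1) + β * x) *
        traceChar F (α * (x + u) ^ (2 ^ e + 1) + β * (x + u)) := by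
    rw [sq, walsh, Finset.sum_mul_sum]
    conv_rhs => rw [Finset.sum_comm]
    refine Finset.sum_congr rfl fun x _ => ?_
    exact (Equiv.sum_comp (Equiv.addLeft x) fun y => traceChar F (α * x ^ (2 ^ e + 1) + β * x) *
        traceChar F (α * y ^ (2 ^ e + 1) + β * y)).symm
  rw [h1, Finset.mul_sum, Finset.sum_filter]
  refine Finset.sum_congr rfl fun u _ => ?_
  have h2 : ∀ x : F, traceChar F (α * x ^ (2 ^ e + 1) + β * x) *
        traceChar F (α * (x + u) ^ (2 ^ e + 1) + β * (x + u)) =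
      traceChar F (α * u ^ (2 ^ e + 1) + β * u) * traceChar F (α * goldForm e u x) := by
    intro x
    rw [← AddChar.map_add_eq_mul, ← AddChar.map_add_eq_mul]
    congr 1
    rw [add_comm x u, add_pow_succ]
    linear_combination (α * x ^ (2 ^ e + 1) + β * x) * CharTwo.two_eq_zero (R := F)
  simp_rw [h2]
  rw [← Finset.mul_sum, sum_traceChar_goldForm hF hme hα]
  split_ifs <;> ring

lemma walsh_sq_of_not_isCubicResidue [DecidableEq F] [CharP F 2] (hF : Fintype.card F = 2 ^ m)
    (hm : m ≠ 0) (hm2 : Even m) (hme : m.Coprime e) {α : F} (hα : α ≠ 0)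
    (hc : ¬ ShortenedCode.IsCubicResidue α) (β : F) : walsh e α β ^ 2 = 2 ^ m := by
  rw [walsh_sq hF hme hα]
  rw [isCubicResidue_iff_exists_mul_pow_eq_one hF hm hm2 hme] at hc
  have : (Finset.univ.filter fun u : F => u = 0 ∨ α * u ^ (2 ^ e + 1) = 1) = {0} := by
    ext u
    simp only [Finset.mem_filter, Finset.mem_univ, true_and, Finset.mem_singleton]
    exact ⟨fun h => h.resolve_right fun h' => hc ⟨u, h'⟩, Or.inl⟩
  rw [this]
  simp

lemma traceChar_one (hF : Fintype.card F = 2 ^ m) (hm2 : Even m) : traceChar F 1 = 1 := by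
  have h : Algebra.trace (ZMod 2) F 1 = (m : ZMod 2) := by
    rw [← map_one (algebraMap (ZMod 2) F), Algebra.trace_algebraMap]
    have h1 : Fintype.card F = _ := Module.card_eq_pow_finrank (K := ZMod 2)
    rw [ZMod.card, hF] at h1
    rw [← Nat.pow_right_injective le_rfl h1]
    simp
  rw [traceChar_apply, h, (ZMod.natCast_eq_zero_iff_even).2 hm2]
  simp

/-- The radical is `{0, y, w * y, w ^ 2 * y}` with `w` a primitive cube root of unity, and `w ^ 2 *
y = y + w * y`. On its nonzero elements the Gold part is `1`, of trace `0` as `m` is even, so the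
sum over the radical factors. -/
lemma walsh_sq_of_isCubicResidue [DecidableEq F] [CharP F 2] (hF : Fintype.card F = 2 ^ m)
    (hm : m ≠ 0) (hm2 : Even m) (hme : m.Coprime e) {α : F}
    (hc : ShortenedCode.IsCubicResidue α) :
    ∃ y z : F, ∀ β : F, walsh e α β ^ 2 =
      2 ^ m * (1 + traceChar F (β * y)) * (1 + traceChar F (β * z)) := by
  have hα : α ≠ 0 := by obtain ⟨z, hz, rfl⟩ := hc; exact pow_ne_zero 3 hz
  rw [isCubicResidue_iff_exists_mul_pow_eq_one hF hm hm2 hme] at hc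
  obtain ⟨y, hy⟩ := hc
  have hy0 : y ≠ 0 := by rintro rfl; simp at hy
  obtain ⟨w, hw, hw1⟩ := exists_cube_root_of_unity hF hm2
  have hw0 : w ≠ 0 := by intro h; rw [h] at hw; simp at hw
  have hw2 : w ^ 2 + w + 1 = 0 := by
    have : (w - 1) * (w ^ 2 + w + 1) = 0 := by linear_combination hw
    exact (mul_eq_zero.1 this).resolve_left (sub_ne_zero.2 hw1)
  have hset : (Finset.univ.filter fun u : F => u = 0 ∨ α * u ^ (2 ^ e + 1) = 1) =
      {0, y, w * y, w ^ 2 * y} := by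
    ext u
    simp only [Finset.mem_filter, Finset.mem_univ, true_and, Finset.mem_insert,
      Finset.mem_singleton]
    by_cases hu : u = 0
    · simp [hu]
    · rw [← hy, mul_right_inj' hα, pow_three_eq_iff_pow_eq hF hm2 hme hu hy0,
        cube_eq_cube_iff hw hw1]
  refine ⟨y, w * y, fun β => ?_⟩
  have hval : ∀ u ∈ ({y, w * y, w ^ 2 * y} : Finset F), α * u ^ (2 ^ e + 1) = 1 := by
    intro u hu
    have hu' : u = 0 ∨ α * u ^ (2 ^ e + 1) = 1 := by
      have : u ∈ (Finset.univ.filter fun u : F => u = 0 ∨ α * u ^ (2 ^ e + 1) = 1) := by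
        rw [hset]; exact Finset.mem_insert_of_mem hu
      simpa using this
    refine hu'.resolve_left ?_
    simp only [Finset.mem_insert, Finset.mem_singleton] at hu
    rcases hu with rfl | rfl | rfl
    · exact hy0
    · exact mul_ne_zero hw0 hy0
    · exact mul_ne_zero (pow_ne_zero _ hw0) hy0
  rw [walsh_sq hF hme hα, hset, Finset.sum_insert, Finset.sum_congr rfl
    (g := fun u => traceChar F (β * u))]
  · have n1 : y ≠ w * y := fun h => hw1 (mul_right_cancel₀ hy0 (by rw [one_mul]; exact h.symm))
    have n2 : y ≠ w ^ 2 * y := fun h => hw1 (by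
      have h2 : w ^ 2 = 1 := mul_right_cancel₀ hy0 (by rw [one_mul]; exact h.symm)
      linear_combination hw - w * h2)
    have n3 : w * y ≠ w ^ 2 * y := fun h => hw1 (by
      have h2 := mul_right_cancel₀ hy0 h
      exact mul_left_cancel₀ hw0 (by linear_combination -h2))
    rw [Finset.sum_insert (by simp [n1, n2]), Finset.sum_insert (by simp [n3]),
      Finset.sum_singleton]
    have h3 : β * (w ^ 2 * y) = β * y + β * (w * y) := by
      linear_combination β * y * hw2 - (β * y + β * (w * y)) * CharTwo.two_eq_zero (R := F)
    rw [h3, AddChar.map_add_eq_mul (traceChar F) (β * y), mul_zero, zero_pow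
      (Nat.succ_ne_zero _), mul_zero, add_zero, AddChar.map_zero_eq_one]
    ring
  · intro u hu
    rw [hval u hu, AddChar.map_add_eq_mul, traceChar_one hF hm2, one_mul]
  · simp [hy0, hw0, Ne.symm hy0]

lemma walsh_sq_eq_of_isCubicResidue [DecidableEq F] [CharP F 2] (hF : Fintype.card F = 2 ^ m)
    (hm : m ≠ 0) (hm2 : Even m) (hme : m.Coprime e) {α : F}
    (hc : ShortenedCode.IsCubicResidue α) (β : F) :
    walsh e α β ^ 2 = 0 ∨ walsh e α β ^ 2 = 4 * 2 ^ m := by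
  obtain ⟨y, z, hy⟩ := walsh_sq_of_isCubicResidue hF hm hm2 hme hc
  rw [hy β]
  rcases traceChar_eq_one_or_neg_one (β * y) with h | h <;> rw [h]
  · rcases traceChar_eq_one_or_neg_one (β * z) with h | h <;> rw [h]
    · right; ring
    · left; ring
  · left; ring

lemma walsh_zero_sq_of_isCubicResidue [DecidableEq F] [CharP F 2] (hF : Fintype.card F = 2 ^ m)
    (hm : m ≠ 0) (hm2 : Even m) (hme : m.Coprime e) {α : F}
    (hc : ShortenedCode.IsCubicResidue α) : walsh e α 0 ^ 2 = 4 * 2 ^ m := by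
  obtain ⟨y, z, hy⟩ := walsh_sq_of_isCubicResidue hF hm hm2 hme hc
  rw [hy 0]
  simp only [zero_mul, AddChar.map_zero_eq_one]
  ring

lemma walsh_zero_left [DecidableEq F] (hF : Fintype.card F = 2 ^ m) (β : F) :
    walsh e 0 β = if β = 0 then 2 ^ m else 0 := by
  have := sum_traceChar_mul β
  rw [hF] at this
  simpa [walsh, mul_comm] using this

/-- The exponent is a multiple of `3`, so the nonzero arguments contribute in equal threes, while
`0` contributes `1`. This congruence fixes the sign of the sum. -/
lemma walsh_zero_modEq [DecidableEq F] (hF : Fintype.card F = 2 ^ m) (hm2 : Even m)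
    (hme : m.Coprime e) (α : F) : ∃ k : ℤ, walsh e α 0 = 1 + 3 * k := by
  have hg := gcd_two_pow_add_one hm2 hme
  obtain ⟨k, hk⟩ : 3 ∣ 2 ^ e + 1 := hg ▸ Nat.gcd_dvd_left _ _
  have hk0 : k ≠ 0 := by rintro rfl; simp at hk
  refine ⟨∑ w ∈ cubes F, traceChar F (α * w ^ k), ?_⟩
  rw [← sum_comp_cube hF hm2 fun w => traceChar F (α * w ^ k), walsh, Finset.filter_ne',
    ← Finset.add_sum_erase _ _ (Finset.mem_univ 0)]
  simp [hk, pow_mul, hk0]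

lemma two_pow_modEq (k : ℕ) : ∃ j : ℤ, (2 : ℤ) ^ k = (-1) ^ k + 3 * j := by
  obtain ⟨j, hj⟩ := sub_dvd_pow_sub_pow (2 : ℤ) (-1) k
  exact ⟨j, by linear_combination hj⟩

lemma walsh_zero_of_not_isCubicResidue [DecidableEq F] [CharP F 2]
    (hF : Fintype.card F = 2 ^ m)
    (hm : m ≠ 0) (hm2 : Even m) (hme : m.Coprime e) {α : F} (hα : α ≠ 0)
    (hc : ¬ ShortenedCode.IsCubicResidue α) :
    walsh e α 0 = (-1) ^ (m / 2) * 2 ^ (m / 2) := by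
  have h := walsh_sq_of_not_isCubicResidue hF hm hm2 hme hα hc 0
  obtain ⟨k, hk⟩ := walsh_zero_modEq hF hm2 hme α
  obtain ⟨j, hj⟩ := two_pow_modEq (m / 2)
  have h2 : (2 : ℤ) ^ m = (2 ^ (m / 2)) ^ 2 := by
    rw [← pow_mul, Nat.div_mul_cancel hm2.two_dvd]
  rw [h2, sq_eq_sq_iff_eq_or_eq_neg] at h
  -- Of the two square roots exactly one is `1` modulo `3`, because `2 ^ (m / 2)` is congruent to
  -- `(-1) ^ (m / 2)`.
  rcases neg_one_pow_eq_or ℤ (m / 2) with h1 | h1 <;> rw [h1] at hj ⊢ <;> omega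

lemma walsh_zero_of_isCubicResidue [DecidableEq F] [CharP F 2]
    (hF : Fintype.card F = 2 ^ m)
    (hm : m ≠ 0) (hm2 : Even m) (hme : m.Coprime e) {α : F}
    (hc : ShortenedCode.IsCubicResidue α) :
    walsh e α 0 = - ((-1) ^ (m / 2) * 2 ^ (m / 2 + 1)) := by
  have h := walsh_zero_sq_of_isCubicResidue hF hm hm2 hme hc
  obtain ⟨k, hk⟩ := walsh_zero_modEq hF hm2 hme α
  obtain ⟨j, hj⟩ := two_pow_modEq (m / 2)
  have h2 : (4 : ℤ) * 2 ^ m = (2 * 2 ^ (m / 2)) ^ 2 := by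
    rw [mul_pow, ← pow_mul, Nat.div_mul_cancel hm2.two_dvd]; norm_num
  rw [h2, sq_eq_sq_iff_eq_or_eq_neg] at h
  rw [pow_succ]
  rcases neg_one_pow_eq_or ℤ (m / 2) with h1 | h1 <;> rw [h1] at hj ⊢ <;> omega

end Walsh

/-! ### Representations by the Gold form. -/

section Count

variable {F : Type*} [Field F] [Fintype F] [DecidableEq F] {m e : ℕ}

/-- The number of representations of `c` by the form `goldForm`. -/
def goldCount (e : ℕ) (c : F) : ℕ :=
  (Finset.univ.filter fun p : F × F => goldForm e p.1 p.2 = c).card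

lemma goldCount_zero [CharP F 2] (hF : Fintype.card F = 2 ^ m) (hme : m.Coprime e) :
    (goldCount e (0 : F) : ℤ) = 3 * 2 ^ m - 2 := by
  have hq : (Fintype.card F : ℤ) = 2 ^ m := by rw [hF]; push_cast; rfl
  have h : ∀ u : F, (∑ v : F, if goldForm e u v = 0 then (1 : ℤ) else 0) =
      2 + if u = 0 then (2 ^ m : ℤ) - 2 else 0 := by
    intro u
    simp_rw [goldForm_eq_zero_iff hF hme]
    by_cases hu : u = 0
    · simp [hu, hq]
    · have : (Finset.univ.filter fun v : F => u = 0 ∨ v = 0 ∨ u = v) = {0, u} := by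
        ext v; simp [hu, eq_comm]
      rw [Finset.sum_boole, this, Finset.card_pair (Ne.symm hu)]
      simp [hu]
  rw [goldCount, Finset.card_filter, Fintype.sum_prod_type]
  push_cast
  simp_rw [h]
  simp [Finset.sum_add_distrib, hq]
  ring

/-- Detect the equation by characters `α`. For `α ≠ 0` the double sum of the form is `q` times the
size of its radical, and the radicals over all `α` reassemble into a Walsh sum at `c`. -/
lemma goldCount_eq [Algebra (ZMod 2) F] [CharP F 2] (hF : Fintype.card F = 2 ^ m)
    (hme : m.Coprime e) {c : F} (hc : c ≠ 0) :
    (goldCount e c : ℤ) = 2 ^ m - 2 + walsh e c 0 := by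
  have hq : (Fintype.card F : ℤ) = 2 ^ m := by rw [hF]; push_cast; rfl
  have hq0 : (2 ^ m : ℤ) ≠ 0 := by positivity
  have h1 : (2 ^ m : ℤ) * goldCount e c =
      ∑ α : F, ∑ p : F × F, traceChar F (α * (c + goldForm e p.1 p.2)) := by
    rw [Finset.sum_comm, goldCount, Finset.card_filter]
    push_cast
    rw [Finset.mul_sum]
    refine Finset.sum_congr rfl fun p _ => ?_
    rw [sum_traceChar_mul, hq]
    simp [CharTwo.add_eq_zero, eq_comm]
  have h2 : ∀ α : F, ∑ p : F × F, traceChar F (α * (c + goldForm e p.1 p.2)) =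
      2 ^ m * (traceChar F (α * c) + (if α = 0 then 2 ^ m - 1 else 0) +
        ∑ u with u ≠ 0, if α * u ^ (2 ^ e + 1) = 1 then traceChar F (α * c) else 0) := by
    intro α
    simp_rw [mul_add, AddChar.map_add_eq_mul]
    rw [← Finset.mul_sum, Fintype.sum_prod_type]
    by_cases hα : α = 0
    · subst hα
      simp [hq]
      ring
    · simp_rw [sum_traceChar_goldForm hF hme hα]
      rw [← Finset.add_sum_erase _ _ (Finset.mem_univ 0), Finset.filter_ne']
      rw [if_pos (Or.inl rfl), if_neg hα]
      simp only [mul_add, mul_zero, add_zero, Finset.mul_sum]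
      congr 1
      · ring
      · refine Finset.sum_congr rfl fun u hu => ?_
        have hu0 := Finset.ne_of_mem_erase hu
        simp only [hu0, false_or]
        split_ifs <;> ring
  -- Each `u` admits the single `α = u⁻¹ ^ (2 ^ e + 1)`; replacing `u` by its inverse gives the
  -- Walsh sum without its term at `0`.
  have h3 : ∑ α : F, ∑ u with u ≠ 0, (if α * u ^ (2 ^ e + 1) = 1 then traceChar F (α * c) else 0) =
      walsh e c 0 - 1 := by
    rw [Finset.sum_comm]
    have h4 : walsh e c 0 - 1 = ∑ u with u ≠ 0, traceChar F (c * u ^ (2 ^ e + 1)) := by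
      rw [walsh, Finset.filter_ne', ← Finset.add_sum_erase _ _ (Finset.mem_univ 0)]
      simp
    rw [h4]
    refine Finset.sum_nbij' (fun u => u⁻¹) (fun u => u⁻¹) ?_ ?_ ?_ ?_ ?_
    · simp
    · simp
    · simp
    · simp
    · intro u hu
      have hu0 : u ≠ 0 := by simpa using hu
      have hp := pow_ne_zero (2 ^ e + 1) hu0
      have h5 : ∀ α : F, α * u ^ (2 ^ e + 1) = 1 ↔ α = (u⁻¹) ^ (2 ^ e + 1) := by
        intro α
        rw [inv_pow]; exact (eq_mul_inv_iff_mul_eq₀ hp (a := α) (b := 1)).symm.trans (by rw [one_mul])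
      simp_rw [h5]
      simp [mul_comm]
  simp_rw [h2] at h1
  rw [← Finset.mul_sum, Finset.sum_add_distrib, Finset.sum_add_distrib, h3,
    sum_traceChar_mul, if_neg hc] at h1
  have h6 := mul_left_cancel₀ hq0 h1
  rw [h6]
  simp
  ring

end Count

/-! ### Triples with given sums and supports of weight six. -/

section Triples

variable {F : Type*} [Field F] [Fintype F] [DecidableEq F] {m e : ℕ}

/-- The three-element sets with prescribed sum and prescribed sum of Gold powers. -/
def tripleSet (e : ℕ) (a b : F) : Finset (Finset F) :=
  (Finset.powersetCard 3 Finset.univ).filter fun U =>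
    ∑ x ∈ U, x = a ∧ ∑ x ∈ U, x ^ (2 ^ e + 1) = b

lemma mem_tripleSet {a b : F} {U : Finset F} :
    U ∈ tripleSet e a b ↔ U.card = 3 ∧ ∑ x ∈ U, x = a ∧ ∑ x ∈ U, x ^ (2 ^ e + 1) = b := by
  simp [tripleSet, Finset.mem_powersetCard]

lemma sum_triple {α M : Type*} [DecidableEq α] [AddCommMonoid M] {x y z : α} (hxy : x ≠ y) (hxz : x ≠ z)
    (hyz : y ≠ z) (f : α → M) : ∑ w ∈ {x, y, z}, f w = f x + f y + f z := by
  rw [Finset.sum_insert (by simp [hxy, hxz]), Finset.sum_pair hyz, add_assoc]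

/-- A pair `(x, y)` determines the third entry `a + x + y`, so each triple arises from its six
ordered pairs of distinct elements. -/
lemma goldCount_eq_six_mul [CharP F 2] {a b : F} (hab : a ^ (2 ^ e + 1) + b ≠ 0) :
    goldCount e (a ^ (2 ^ e + 1) + b) = 6 * (tripleSet e a b).card := by
  have two := CharTwo.two_eq_zero (R := F)
  set D := Finset.univ.filter fun p : F × F =>
    p.1 ^ (2 ^ e + 1) + p.2 ^ (2 ^ e + 1) + (a + p.1 + p.2) ^ (2 ^ e + 1) = b with hD
  have h1 : goldCount e (a ^ (2 ^ e + 1) + b) = D.card := by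
    refine Finset.card_nbij' (fun p => (p.1 + a, p.2 + a)) (fun p => (p.1 + a, p.2 + a)) ?_ ?_
      ?_ ?_
    · rintro ⟨u, v⟩ h
      simp only [Finset.coe_filter, Finset.mem_univ, true_and, Set.mem_ofPred_eq, hD] at h ⊢
      rw [pow_add_pow_add_pow]
      simp only [add_assoc, CharTwo.add_self_eq_zero, add_zero, h]
      rw [← add_assoc, CharTwo.add_self_eq_zero, zero_add]
    · rintro ⟨u, v⟩ h
      simp only [Finset.coe_filter, Finset.mem_univ, true_and, Set.mem_ofPred_eq, hD] at h ⊢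
      rw [pow_add_pow_add_pow] at h
      linear_combination h - a ^ (2 ^ e + 1) * two
    · rintro ⟨u, v⟩ _
      simp [add_assoc, CharTwo.add_self_eq_zero]
    · rintro ⟨u, v⟩ _
      simp [add_assoc, CharTwo.add_self_eq_zero]
  -- If two entries agreed they would cancel, the third would be `a`, and `b` would be its Gold
  -- power, against `hab`.
  have hne : ∀ x y : F, (x, y) ∈ D → x ≠ y ∧ x ≠ a + x + y ∧ y ≠ a + x + y := by
    intro x y h
    simp only [Finset.mem_filter, Finset.mem_univ, true_and, hD] at h
    refine ⟨?_, ?_, ?_⟩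
    · rintro rfl
      apply hab
      have : a + x + x = a := by linear_combination x * two
      rw [this] at h
      linear_combination h - x ^ (2 ^ e + 1) * two + b * two
    · intro hy
      have hy' : y = a := by linear_combination -hy - a * two
      subst hy'
      apply hab
      have : y + x + y = x := by linear_combination y * two
      rw [this] at h
      linear_combination h - x ^ (2 ^ e + 1) * two + b * two
    · intro hy
      have hy' : x = a := by linear_combination -hy - a * two
      subst hy'
      apply hab
      have : x + x + y = y := by linear_combination x * two
      rw [this] at h
      linear_combination h - y ^ (2 ^ e + 1) * two + b * two
  have hmaps : ∀ p ∈ D, ({p.1, p.2, a + p.1 + p.2} : Finset F) ∈ tripleSet e a b := by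
    rintro ⟨x, y⟩ h
    obtain ⟨n1, n2, n3⟩ := hne x y h
    simp only [Finset.mem_filter, Finset.mem_univ, true_and, hD] at h
    rw [mem_tripleSet, sum_triple n1 n2 n3, sum_triple n1 n2 n3]
    refine ⟨Finset.card_eq_three.2 ⟨x, y, _, n1, n2, n3, rfl⟩, ?_, h⟩
    linear_combination (x + y) * two
  rw [h1, Finset.card_eq_sum_card_fiberwise hmaps, mul_comm]
  apply Finset.sum_const_nat
  intro U hU
  have hU3 := (mem_tripleSet.1 hU).1
  have : (Finset.filter (fun p : F × F => ({p.1, p.2, a + p.1 + p.2} : Finset F) = U) D) =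
      U.offDiag := by
    ext ⟨x, y⟩
    rw [Finset.mem_filter, Finset.mem_offDiag]
    constructor
    · rintro ⟨h, rfl⟩
      exact ⟨by simp, by simp, (hne x y h).1⟩
    · rintro ⟨hx, hy, hxy⟩
      obtain ⟨z, hz⟩ : ∃ z, (U.erase x).erase y = {z} := by
        rw [← Finset.card_eq_one, Finset.card_erase_of_mem (Finset.mem_erase.2 ⟨Ne.symm hxy, hy⟩),
          Finset.card_erase_of_mem hx, hU3]
      have hzm : z ∈ (U.erase x).erase y := by rw [hz]; simp
      simp only [Finset.mem_erase] at hzm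
      have hUe : U = {x, y, z} := by
        rw [← hz, Finset.insert_erase (Finset.mem_erase.2 ⟨Ne.symm hxy, hy⟩),
          Finset.insert_erase hx]
      obtain ⟨_, hs, hp⟩ := mem_tripleSet.1 hU
      rw [hUe, sum_triple hxy (Ne.symm hzm.2.1) (Ne.symm hzm.1)] at hs hp
      have hza : a + x + y = z := by rw [← hs]; linear_combination (x + y) * two
      refine ⟨?_, ?_⟩
      · simp only [Finset.mem_filter, Finset.mem_univ, true_and, hD]
        rw [hza, hp]
      · simp only [hza, hUe]
  rw [this, Finset.offDiag_card, hU3]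

/-- Removing the common element leaves two pairs with equal sums, to which `pair_eq_of_sums`
applies. -/
lemma eq_of_mem_tripleSet_of_mem [CharP F 2] (hF : Fintype.card F = 2 ^ m) (hme : m.Coprime e)
    {a b x : F} {T U : Finset F} (hT : T ∈ tripleSet e a b) (hU : U ∈ tripleSet e a b)
    (hxT : x ∈ T) (hxU : x ∈ U) : U = T := by
  obtain ⟨cT, sT, pT⟩ := mem_tripleSet.1 hT
  obtain ⟨cU, sU, pU⟩ := mem_tripleSet.1 hU
  have h2T : (T.erase x).card = 2 := by rw [Finset.card_erase_of_mem hxT, cT]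
  have h2U : (U.erase x).card = 2 := by rw [Finset.card_erase_of_mem hxU, cU]
  obtain ⟨s, t, hst, hTe⟩ := Finset.card_eq_two.1 h2T
  obtain ⟨y, z, hyz, hUe⟩ := Finset.card_eq_two.1 h2U
  rw [← Finset.add_sum_erase _ _ hxT, hTe, Finset.sum_pair hst] at sT pT
  rw [← Finset.add_sum_erase _ _ hxU, hUe, Finset.sum_pair hyz] at sU pU
  rw [← sT] at sU
  rw [← pT] at pU
  have : ({y, z} : Finset F) = {s, t} := by
    rcases pair_eq_of_sums hF hme hst (add_left_cancel sU) (add_left_cancel pU) with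
      ⟨rfl, rfl⟩ | ⟨rfl, rfl⟩
    · rfl
    · exact Finset.pair_comm _ _
  rw [← Finset.insert_erase hxU, hUe, this, ← hTe, Finset.insert_erase hxT]

variable [Algebra (ZMod 2) F]

lemma eq_zero_of_forall_trace {z : F} (h : ∀ x : F, Algebra.trace (ZMod 2) F (x * z) = 0) :
    z = 0 := by
  by_contra hz
  have h1 := sum_traceChar_mul z
  rw [if_neg hz] at h1
  simp only [traceChar_apply, h, AddChar.map_zero_eq_one] at h1
  simp at h1

lemma eq_indicator {ι : Type*} [Fintype ι] [DecidableEq ι] (c : ι → ZMod 2) (x : ι) :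
    c x = if x ∈ ShortenedCode.supp c then 1 else 0 := by
  simp only [ShortenedCode.supp, Finset.mem_filter, Finset.mem_univ, true_and]
  generalize c x = z
  revert z
  decide

/-- The three coefficients vary independently and the trace pairing is nondegenerate. -/
lemma mem_dualCode_iff (n : ℕ) (c : F → ZMod 2) :
    c ∈ ShortenedCode.dualCode (ShortenedCode.traceCode (ZMod 2) (X ^ n : F[X])) ↔
      ∑ x ∈ ShortenedCode.supp c, x ^ n = 0 ∧ ∑ x ∈ ShortenedCode.supp c, x = 0 ∧
        ((ShortenedCode.supp c).card : F) = 0 := by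
  have key : ∀ α β γ : F, (c ⬝ᵥ fun x => Algebra.trace (ZMod 2) F
      (α * (X ^ n : F[X]).eval x + β * x + γ)) = Algebra.trace (ZMod 2) F
        (α * ∑ x ∈ ShortenedCode.supp c, x ^ n + β * ∑ x ∈ ShortenedCode.supp c, x +
          γ * (ShortenedCode.supp c).card) := by
    intro α β γ
    rw [dotProduct, Finset.mul_sum, Finset.mul_sum, ← Finset.sum_add_distrib, mul_comm γ,
      ← nsmul_eq_mul, ← Finset.sum_const, ← Finset.sum_add_distrib, map_sum]
    simp_rw [eq_indicator c, ite_mul, one_mul, zero_mul]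
    rw [← Finset.sum_filter, Finset.filter_mem_eq_inter, Finset.univ_inter]
    simp
  constructor
  · intro h
    have h' : ∀ α β γ : F, Algebra.trace (ZMod 2) F
        (α * ∑ x ∈ ShortenedCode.supp c, x ^ n + β * ∑ x ∈ ShortenedCode.supp c, x +
          γ * (ShortenedCode.supp c).card) = 0 := fun α β γ => by
      rw [← key]; exact h _ ⟨α, β, γ, rfl⟩
    refine ⟨eq_zero_of_forall_trace fun x => ?_, eq_zero_of_forall_trace fun x => ?_,
      eq_zero_of_forall_trace fun x => ?_⟩
    · simpa using h' x 0 0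
    · simpa using h' 0 x 0
    · simpa using h' 0 0 x
  · rintro ⟨h1, h2, h3⟩ _ ⟨α, β, γ, rfl⟩
    rw [key, h1, h2, h3]
    simp

lemma mem_supports_six_iff [CharP F 2] (n : ℕ) (S : Finset F) :
    S ∈ ShortenedCode.supports (ShortenedCode.dualCode
      (ShortenedCode.traceCode (ZMod 2) (X ^ n : F[X]))) 6 ↔
      S.card = 6 ∧ ∑ x ∈ S, x ^ n = 0 ∧ ∑ x ∈ S, x = 0 := by
  have h6 : ((6 : ℕ) : F) = 0 := by
    rw [CharP.cast_eq_zero_iff F 2]; norm_num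
  constructor
  · rintro ⟨c, hc, hn, rfl⟩
    obtain ⟨h1, h2, _⟩ := (mem_dualCode_iff n c).1 hc
    exact ⟨hn, h1, h2⟩
  · rintro ⟨hn, h1, h2⟩
    have hs : ShortenedCode.supp (fun x => if x ∈ S then (1 : ZMod 2) else 0) = S := by
      ext x; simp [ShortenedCode.supp]
    refine ⟨fun x => if x ∈ S then 1 else 0, ?_, ?_, hs⟩
    · rw [mem_dualCode_iff, hs, hn, h6]
      exact ⟨h1, h2, rfl⟩
    · rw [← hn]
      exact congrArg Finset.card hs

/-- Supports `S` containing `T` correspond to the triples `S \ T`; the extra `1` is `T` itself. -/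
lemma lam_add_one [CharP F 2] (hF : Fintype.card F = 2 ^ m) (hme : m.Coprime e) {a b : F}
    {T : Finset F} (hT : T ∈ tripleSet e a b) :
    ShortenedCode.lam (ShortenedCode.dualCode
      (ShortenedCode.traceCode (ZMod 2) (X ^ (2 ^ e + 1) : F[X]))) T 6 + 1 =
      (tripleSet e a b).card := by
  have two := CharTwo.two_eq_zero (R := F)
  obtain ⟨cT, sT, pT⟩ := mem_tripleSet.1 hT
  have hdisj : ∀ U ∈ (tripleSet e a b).erase T, Disjoint T U := by
    intro U hU
    rw [Finset.mem_erase] at hU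
    rw [Finset.disjoint_left]
    exact fun x hxT hxU => hU.1 (eq_of_mem_tripleSet_of_mem hF hme hT hU.2 hxT hxU)
  have hset : {S : Finset F | S ∈ ShortenedCode.supports (ShortenedCode.dualCode
      (ShortenedCode.traceCode (ZMod 2) (X ^ (2 ^ e + 1) : F[X]))) 6 ∧ T ⊆ S} =
      (((tripleSet e a b).erase T).image fun U => T ∪ U : Finset (Finset F)) := by
    ext S
    rw [Set.mem_ofPred_eq, mem_supports_six_iff, Finset.mem_coe, Finset.mem_image]
    constructor
    · rintro ⟨⟨hS, h1, h2⟩, hTS⟩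
      have e1 := Finset.sum_sdiff (f := fun x : F => x) hTS
      have e2 := Finset.sum_sdiff (f := fun x : F => x ^ (2 ^ e + 1)) hTS
      simp only [h1, h2, sT, pT] at e1 e2
      refine ⟨S \ T, Finset.mem_erase.2 ⟨?_, mem_tripleSet.2 ⟨?_, ?_, ?_⟩⟩,
        Finset.union_sdiff_of_subset hTS⟩
      · intro h
        have hd : Disjoint (S \ T) T := Finset.sdiff_disjoint
        rw [h, disjoint_self, Finset.bot_eq_empty] at hd
        rw [hd] at cT
        simp at cT
      · rw [Finset.card_sdiff_of_subset hTS, hS, cT]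
      · linear_combination e1 - a * two
      · linear_combination e2 - b * two
    · rintro ⟨U, hU, rfl⟩
      have hd := hdisj U hU
      obtain ⟨cU, sU, pU⟩ := mem_tripleSet.1 (Finset.mem_erase.1 hU).2
      refine ⟨⟨?_, ?_, ?_⟩, Finset.subset_union_left⟩
      · rw [Finset.card_union_of_disjoint hd, cT, cU]
      · rw [Finset.sum_union hd, pT, pU, CharTwo.add_self_eq_zero]
      · rw [Finset.sum_union hd, sT, sU, CharTwo.add_self_eq_zero]
  rw [ShortenedCode.lam, hset, Set.ncard_coe_finset, Finset.card_image_of_injOn,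
    Finset.card_erase_add_one hT]
  intro U hU U' hU' h
  have := congrArg (· \ T) h
  simpa [Finset.union_sdiff_left, (hdisj U hU).symm.sdiff_eq_left,
    (hdisj U' hU').symm.sdiff_eq_left] using this

end Triples

/-! ### Moments of character sums as counts of column sums. -/

section Moments

variable {F : Type*} [Field F] [Fintype F] [DecidableEq F] [Algebra (ZMod 2) F] {m e : ℕ}

/-- The trace pairing on `F × F × GF(2)`. -/
def pairing (p v : F × F × ZMod 2) : ZMod 2 :=
  Algebra.trace (ZMod 2) F (p.1 * v.1 + p.2.1 * v.2.1) + p.2.2 * v.2.2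

/-- The column of the parity check matrix at the position `x`. -/
def column (e : ℕ) (x : F) : F × F × ZMod 2 := (x ^ (2 ^ e + 1), x, 1)

omit [Fintype F] [DecidableEq F] in
lemma pairing_zero_right (p : F × F × ZMod 2) : pairing p 0 = 0 := by simp [pairing]

omit [Fintype F] [DecidableEq F] in
lemma pairing_add_right (p v w : F × F × ZMod 2) :
    pairing p (v + w) = pairing p v + pairing p w := by
  simp only [pairing, Prod.fst_add, Prod.snd_add, mul_add, map_add]
  ring

lemma sum_sgn_pairing_snd (hF : Fintype.card F = 2 ^ m) (α : F) (v : F × F × ZMod 2) :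
    ∑ r : F × ZMod 2, sgn (pairing (α, r) v) =
      if v.2 = 0 then 2 * 2 ^ m * traceChar F (α * v.1) else 0 := by
  have h : ∀ r : F × ZMod 2, sgn (pairing (α, r) v) =
      traceChar F (α * v.1) * (traceChar F (r.1 * v.2.1) * sgn (r.2 * v.2.2)) := by
    intro r
    rw [pairing, map_add (Algebra.trace (ZMod 2) F), AddChar.map_add_eq_mul,
      AddChar.map_add_eq_mul, mul_assoc]
    rfl
  simp_rw [h]
  rw [← Finset.mul_sum, Fintype.sum_prod_type]
  simp_rw [← Finset.mul_sum]
  rw [← Finset.sum_mul, sum_sgn_mul, sum_traceChar_mul, hF]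
  by_cases h1 : v.2.1 = 0 <;> by_cases h2 : v.2.2 = 0 <;> simp [Prod.ext_iff, h1, h2]
  ring

lemma sum_sgn_pairing (hF : Fintype.card F = 2 ^ m) (v : F × F × ZMod 2) :
    ∑ p : F × F × ZMod 2, sgn (pairing p v) = if v = 0 then 2 * (2 ^ m) ^ 2 else 0 := by
  rw [Fintype.sum_prod_type]
  simp_rw [sum_sgn_pairing_snd hF]
  by_cases h2 : v.2 = 0
  · simp_rw [if_pos h2]
    rw [← Finset.mul_sum, sum_traceChar_mul, hF]
    by_cases h1 : v.1 = 0 <;> simp [Prod.ext_iff (y := (0 : F × F × ZMod 2)), h1, h2]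
    ring
  · simp [Prod.ext_iff (y := (0 : F × F × ZMod 2)), h2]

/-- The parameters of the codewords that vanish on `T`. -/
def vanishing (e : ℕ) (T : Finset F) : Finset (F × F × ZMod 2) :=
  Finset.univ.filter fun p => ∀ t ∈ T, pairing p (column e t) = 0

/-- The sum over subsets expands the product of `1 + sgn (pairing p (column e t))` over `t ∈ T`,
whose factors are `2` or `0`. It serves as the indicator of vanishing on `T`. -/
lemma sum_powerset_sgn (T : Finset F) (p : F × F × ZMod 2) :
    ∑ S ∈ T.powerset, sgn (pairing p (∑ s ∈ S, column e s)) =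
      if p ∈ vanishing e T then 2 ^ T.card else 0 := by
  have h : ∀ S : Finset F, sgn (pairing p (∑ s ∈ S, column e s)) =
      ∏ s ∈ S, sgn (pairing p (column e s)) := by
    intro S
    induction S using Finset.induction_on with
    | empty => simp [pairing_zero_right]
    | insert s S hs ih =>
      rw [Finset.sum_insert hs, Finset.prod_insert hs, pairing_add_right,
        AddChar.map_add_eq_mul, ih]
  simp_rw [h]
  rw [← Finset.prod_one_add]
  split_ifs with hp
  · simp only [vanishing, Finset.mem_filter, Finset.mem_univ, true_and] at hp
    rw [Finset.prod_congr rfl (g := fun _ => 2), Finset.prod_const]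
    intro t ht
    rw [hp t ht]
    rfl
  · simp only [vanishing, Finset.mem_filter, Finset.mem_univ, true_and, not_forall] at hp
    obtain ⟨t, ht, h1⟩ := hp
    refine Finset.prod_eq_zero ht ?_
    rw [sgn_apply, if_neg h1]
    rfl

/-- The character sum of a codeword. -/
def wordSum (e : ℕ) (p : F × F × ZMod 2) : ℤ := ∑ x : F, sgn (pairing p (column e x))

omit [DecidableEq F] in
lemma wordSum_eq (p : F × F × ZMod 2) : wordSum e p = sgn p.2.2 * walsh e p.1 p.2.1 := by
  rw [wordSum, walsh, Finset.mul_sum]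
  refine Finset.sum_congr rfl fun x _ => ?_
  rw [pairing, AddChar.map_add_eq_mul, mul_comm]
  simp [column, traceChar_apply]

/-- The number of ways to write `v` as a sum of `k` columns. -/
def columnCount (e : ℕ) : ℕ → F × F × ZMod 2 → ℤ
  | 0, v => if v = 0 then 1 else 0
  | k + 1, v => ∑ x : F, columnCount e k (v + column e x)

lemma sum_sgn_pairing_mul_wordSum_pow (hF : Fintype.card F = 2 ^ m) (k : ℕ) :
    ∀ v : F × F × ZMod 2, ∑ p, sgn (pairing p v) * wordSum e p ^ k =
      2 * (2 ^ m) ^ 2 * columnCount e k v := by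
  induction k with
  | zero => intro v; simp [columnCount, sum_sgn_pairing hF]
  | succ k ih =>
    intro v
    rw [columnCount, Finset.mul_sum]
    simp_rw [← ih, pairing_add_right, AddChar.map_add_eq_mul]
    rw [Finset.sum_comm]
    refine Finset.sum_congr rfl fun p _ => ?_
    rw [pow_succ]
    nth_rewrite 2 [wordSum]
    rw [Finset.mul_sum, Finset.mul_sum]
    refine Finset.sum_congr rfl fun x _ => ?_
    ring

/-- Replace the indicator of vanishing on `T` by its subset expansion and exchange the sums. -/
lemma two_pow_card_mul_moment (hF : Fintype.card F = 2 ^ m) (T : Finset F) (k : ℕ) :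
    2 ^ T.card * ∑ p ∈ vanishing e T, wordSum e p ^ k =
      2 * (2 ^ m) ^ 2 * ∑ S ∈ T.powerset, columnCount e k (∑ s ∈ S, column e s) := by
  rw [Finset.mul_sum, Finset.mul_sum]
  simp_rw [← sum_sgn_pairing_mul_wordSum_pow hF]
  rw [Finset.sum_comm]
  simp_rw [← Finset.sum_mul, sum_powerset_sgn, ite_mul, zero_mul]
  rw [← Finset.sum_filter, Finset.filter_mem_eq_inter, Finset.univ_inter]

-- Every column ends in `1`, so the last coordinate records the parity of the number of columns.
omit [Algebra (ZMod 2) F] in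
lemma columnCount_eq_zero {k : ℕ} : ∀ {v : F × F × ZMod 2}, v.2.2 ≠ k → columnCount e k v = 0 := by
  induction k with
  | zero =>
    intro v hv
    rw [columnCount, if_neg]
    rintro rfl
    simp at hv
  | succ k ih =>
    intro v hv
    rw [columnCount]
    refine Finset.sum_eq_zero fun x _ => ih ?_
    intro h
    apply hv
    rw [Nat.cast_succ, ← h]
    simp [column, add_assoc, CharTwo.add_self_eq_zero]

omit [Fintype F] [DecidableEq F] [Algebra (ZMod 2) F] in
lemma column_add_column (s t : F) :
    column e s + column e t = (s ^ (2 ^ e + 1) + t ^ (2 ^ e + 1), s + t, 0) := by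
  simp only [column, Prod.mk_add_mk, CharTwo.add_self_eq_zero]

omit [Fintype F] [DecidableEq F] [Algebra (ZMod 2) F] in
lemma column_add_column_add (r s t : F) :
    column e r + (column e s + column e t) =
      (r ^ (2 ^ e + 1) + (s ^ (2 ^ e + 1) + t ^ (2 ^ e + 1)), r + (s + t), 1) := by
  rw [column_add_column, column, Prod.mk_add_mk, Prod.mk_add_mk, add_zero]

omit [Algebra (ZMod 2) F] in
lemma columnCount_one [CharP F 2] (A B : F) :
    columnCount e 1 (A, B, 1) = if A = B ^ (2 ^ e + 1) then 1 else 0 := by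
  have h : ∀ x : F, columnCount e 0 ((A, B, 1) + column e x) =
      if x = B then (if A = B ^ (2 ^ e + 1) then 1 else 0) else 0 := by
    intro x
    rw [columnCount, ← ite_and]
    refine if_congr ?_ rfl rfl
    simp only [column, Prod.mk_add_mk, Prod.mk_eq_zero, CharTwo.add_eq_zero, and_true]
    constructor
    · rintro ⟨h1, rfl⟩
      exact ⟨rfl, h1⟩
    · rintro ⟨rfl, h1⟩
      exact ⟨h1, rfl⟩
  rw [columnCount]
  simp_rw [h]
  simp

omit [Algebra (ZMod 2) F] in
lemma columnCount_two [CharP F 2] (A B : F) :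
    columnCount e 2 (A, B, 0) = ((Finset.univ.filter fun x : F =>
      A + x ^ (2 ^ e + 1) = (B + x) ^ (2 ^ e + 1)).card : ℤ) := by
  rw [columnCount, Finset.card_filter]
  push_cast
  refine Finset.sum_congr rfl fun x _ => ?_
  rw [← columnCount_one, column, Prod.mk_add_mk, Prod.mk_add_mk, zero_add]

omit [Algebra (ZMod 2) F] in
lemma columnCount_two_zero [CharP F 2] (hF : Fintype.card F = 2 ^ m) :
    columnCount e 2 (0 : F × F × ZMod 2) = 2 ^ m := by
  have := columnCount_two (e := e) (0 : F) 0
  simpa [hF, Prod.zero_eq_mk] using this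

omit [Algebra (ZMod 2) F] in
lemma columnCount_two_add [CharP F 2] (hF : Fintype.card F = 2 ^ m) (hme : m.Coprime e)
    {s t : F} (hst : s ≠ t) : columnCount e 2 (column e s + column e t) = 2 := by
  have two := CharTwo.two_eq_zero (R := F)
  have : (Finset.univ.filter fun x : F => s ^ (2 ^ e + 1) + t ^ (2 ^ e + 1) + x ^ (2 ^ e + 1) =
      (s + t + x) ^ (2 ^ e + 1)) = {s, t} := by
    ext x
    simp only [Finset.mem_filter, Finset.mem_univ, true_and,
      Finset.mem_insert, Finset.mem_singleton]
    constructor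
    · intro h
      have := pair_eq_of_sums hF hme hst (x := x) (y := s + t + x)
        (by linear_combination x * two)
        (by rw [← h]; linear_combination x ^ (2 ^ e + 1) * two)
      exact this.imp And.left And.left
    · rintro (rfl | rfl)
      · have : x + t + x = t := by linear_combination x * two
        rw [this]; linear_combination x ^ (2 ^ e + 1) * two
      · have : s + x + x = s := by linear_combination x * two
        rw [this]; linear_combination x ^ (2 ^ e + 1) * two
  rw [column_add_column, columnCount_two, this, Finset.card_pair hst]
  rfl

-- Shifting two of the three summands by `B` turns the column equations into one equation for the
-- form.
omit [Algebra (ZMod 2) F] in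
lemma columnCount_three [CharP F 2] (A B : F) :
    columnCount e 3 (A, B, 1) = goldCount e (B ^ (2 ^ e + 1) + A) := by
  have two := CharTwo.two_eq_zero (R := F)
  have h : ∀ x : F, columnCount e 2 ((A, B, 1) + column e x) = ∑ y : F,
      if goldForm e (x + B) (y + B) = B ^ (2 ^ e + 1) + A then (1 : ℤ) else 0 := by
    intro x
    have h0 : (A, B, (1 : ZMod 2)) + column e x = (A + x ^ (2 ^ e + 1), B + x, 0) := by
      simp only [column, Prod.mk_add_mk, CharTwo.add_self_eq_zero]
    rw [h0, columnCount_two, Finset.card_filter]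
    push_cast
    refine Finset.sum_congr rfl fun y _ => if_congr ?_ rfl rfl
    have h1 := pow_add_pow_add_pow e B x y
    constructor
    · intro h
      linear_combination -h - h1 + (x ^ (2 ^ e + 1) + y ^ (2 ^ e + 1) - B ^ (2 ^ e + 1)) * two
    · intro h
      linear_combination -h - h1 + (x ^ (2 ^ e + 1) + y ^ (2 ^ e + 1) - B ^ (2 ^ e + 1)) * two
  rw [columnCount]
  simp_rw [h]
  rw [goldCount, Finset.card_filter, Fintype.sum_prod_type]
  push_cast
  rw [← Equiv.sum_comp (Equiv.addRight B)
    fun x => ∑ y, if goldForm e x y = B ^ (2 ^ e + 1) + A then (1 : ℤ) else 0]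
  refine Finset.sum_congr rfl fun x _ => ?_
  exact (Equiv.sum_comp (Equiv.addRight B)
    fun y => if goldForm e (x + B) y = B ^ (2 ^ e + 1) + A then (1 : ℤ) else 0)

omit [Fintype F] [Algebra (ZMod 2) F] in
lemma sum_powerset_triple {M : Type*} [AddCommMonoid M] {r s t : F} (hrs : r ≠ s) (hrt : r ≠ t)
    (hst : s ≠ t) (f : F × F × ZMod 2 → M) (g : F → F × F × ZMod 2) :
    ∑ S ∈ ({r, s, t} : Finset F).powerset, f (∑ x ∈ S, g x) =
      f 0 + (f (g r) + f (g s) + f (g t)) + (f (g r + g s) + f (g r + g t) + f (g s + g t)) +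
        f (g r + (g s + g t)) := by
  have h1 : s ∉ ({t} : Finset F) := by simpa using hst
  have h2 : r ∉ ({s, t} : Finset F) := by simp [hrs, hrt]
  have hp : ∀ S ∈ ({s, t} : Finset F).powerset, ∑ x ∈ insert r S, g x = g r + ∑ x ∈ S, g x :=
    fun S hS => Finset.sum_insert fun h => h2 (Finset.mem_powerset.1 hS h)
  have hp' : ∀ S ∈ ({t} : Finset F).powerset, ∑ x ∈ insert s S, g x = g s + ∑ x ∈ S, g x :=
    fun S hS => Finset.sum_insert fun h => h1 (Finset.mem_powerset.1 hS h)
  have ht : ({t} : Finset F).powerset = {∅, {t}} := rfl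
  have h3 : ∀ h : F × F × ZMod 2 → M, ∑ S ∈ ({s, t} : Finset F).powerset, h (∑ x ∈ S, g x) =
      h 0 + h (g t) + (h (g s) + h (g s + g t)) := by
    intro h
    have h4 : ∑ S ∈ ({t} : Finset F).powerset, h (∑ x ∈ insert s S, g x) =
        ∑ S ∈ ({t} : Finset F).powerset, h (g s + ∑ x ∈ S, g x) :=
      Finset.sum_congr rfl fun S hS => by rw [hp' S hS]
    rw [Finset.sum_powerset_insert h1, h4, ht, Finset.sum_pair (Finset.singleton_ne_empty t).symm,
      Finset.sum_pair (Finset.singleton_ne_empty t).symm]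
    simp
  have h5 : ∑ S ∈ ({s, t} : Finset F).powerset, f (∑ x ∈ insert r S, g x) =
      ∑ S ∈ ({s, t} : Finset F).powerset, f (g r + ∑ x ∈ S, g x) :=
    Finset.sum_congr rfl fun S hS => by rw [hp S hS]
  rw [Finset.sum_powerset_insert h2, h3, h5, h3 fun v => f (g r + v)]
  simp only [add_zero]
  abel

lemma four_mul_moment [CharP F 2] (hF : Fintype.card F = 2 ^ m) {T : Finset F} (hT : T.card = 3)
    (k : ℕ) : 4 * ∑ p ∈ vanishing e T, wordSum e p ^ k =
      (2 ^ m) ^ 2 * ∑ S ∈ T.powerset, columnCount e k (∑ s ∈ S, column e s) := by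
  have h := two_pow_card_mul_moment (e := e) hF T k
  rw [hT] at h
  linarith

/-! ### The moments of orders zero to three, and the words with fixed leading coefficient. -/

variable [CharP F 2] (hF : Fintype.card F = 2 ^ m) (hme : m.Coprime e) {T : Finset F}
  (hT : T.card = 3)

include hF hT in
lemma moment_zero : 4 * ((vanishing e T).card : ℤ) = (2 ^ m) ^ 2 := by
  have h := four_mul_moment (e := e) hF hT 0
  obtain ⟨r, s, t, hrs, hrt, hst, rfl⟩ := Finset.card_eq_three.1 hT
  rw [sum_powerset_triple hrs hrt hst] at h
  have n1 : ∀ x : F, columnCount e 0 (column e x) = 0 := fun x =>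
    columnCount_eq_zero (by simp [column])
  have n2 : ∀ x y : F, x ≠ y → columnCount e 0 (column e x + column e y) = 0 := by
    intro x y hxy
    rw [columnCount, if_neg]
    exact fun h => hxy (CharTwo.add_eq_zero.1 (congrArg (fun v => v.2.1) h))
  have n3 : columnCount e 0 (column e r + (column e s + column e t)) = 0 :=
    columnCount_eq_zero (show (1 + (1 + 1) : ZMod 2) ≠ (0 : ℕ) by decide)
  rw [n1, n1, n1, n2 _ _ hrs, n2 _ _ hrt, n2 _ _ hst, n3] at h
  simpa [columnCount] using h

include hF hme hT in
lemma moment_one : 4 * ∑ p ∈ vanishing e T, wordSum e p = 3 * (2 ^ m) ^ 2 := by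
  have h := four_mul_moment (e := e) hF hT 1
  obtain ⟨r, s, t, hrs, hrt, hst, rfl⟩ := Finset.card_eq_three.1 hT
  rw [sum_powerset_triple hrs hrt hst] at h
  have n0 : columnCount e 1 (0 : F × F × ZMod 2) = 0 := columnCount_eq_zero (by simp)
  have n1 : ∀ x : F, columnCount e 1 (column e x) = 1 := fun x => by
    rw [column, columnCount_one, if_pos rfl]
  have n2 : ∀ x y : F, columnCount e 1 (column e x + column e y) = 0 := fun x y =>
    columnCount_eq_zero (show (1 + 1 : ZMod 2) ≠ (1 : ℕ) by decide)
  -- The sum of the three columns at `T` is not itself a column.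
  have n3 : columnCount e 1 (column e r + (column e s + column e t)) = 0 := by
    rw [column_add_column_add, columnCount_one, if_neg]
    intro h
    apply pow_add_sum_ne_zero hF hme hrs hrt hst
    rw [add_assoc r, ← h, ← add_assoc (r ^ _), CharTwo.add_self_eq_zero]
  rw [n0, n1, n1, n1, n2, n2, n2, n3] at h
  simp only [pow_one] at h
  rw [h]
  ring

include hF hme hT in
lemma moment_two : 4 * ∑ p ∈ vanishing e T, wordSum e p ^ 2 = (2 ^ m) ^ 2 * (2 ^ m + 6) := by
  have h := four_mul_moment (e := e) hF hT 2
  obtain ⟨r, s, t, hrs, hrt, hst, rfl⟩ := Finset.card_eq_three.1 hT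
  rw [sum_powerset_triple hrs hrt hst] at h
  have n1 : ∀ x : F, columnCount e 2 (column e x) = 0 := fun x =>
    columnCount_eq_zero (show (1 : ZMod 2) ≠ (2 : ℕ) by decide)
  have n3 : columnCount e 2 (column e r + (column e s + column e t)) = 0 :=
    columnCount_eq_zero (show (1 + (1 + 1) : ZMod 2) ≠ (2 : ℕ) by decide)
  rw [columnCount_two_zero hF, n1, n1, n1, columnCount_two_add hF hme hrs,
    columnCount_two_add hF hme hrt, columnCount_two_add hF hme hst, n3] at h
  rw [h]
  ring

include hF hme hT in
lemma moment_three : 4 * ∑ p ∈ vanishing e T, wordSum e p ^ 3 = (2 ^ m) ^ 2 * (9 * 2 ^ m - 6 +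
    goldCount e ((∑ x ∈ T, x) ^ (2 ^ e + 1) + ∑ x ∈ T, x ^ (2 ^ e + 1))) := by
  have h := four_mul_moment (e := e) hF hT 3
  obtain ⟨r, s, t, hrs, hrt, hst, rfl⟩ := Finset.card_eq_three.1 hT
  rw [sum_powerset_triple hrs hrt hst] at h
  have n0 : columnCount e 3 (0 : F × F × ZMod 2) = 0 :=
    columnCount_eq_zero (show (0 : ZMod 2) ≠ (3 : ℕ) by decide)
  have n1 : ∀ x : F, columnCount e 3 (column e x) = 3 * 2 ^ m - 2 := fun x => by
    rw [column, columnCount_three, CharTwo.add_self_eq_zero]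
    exact goldCount_zero hF hme
  have n2 : ∀ x y : F, columnCount e 3 (column e x + column e y) = 0 := fun x y =>
    columnCount_eq_zero (show (1 + 1 : ZMod 2) ≠ (3 : ℕ) by decide)
  have n3 : columnCount e 3 (column e r + (column e s + column e t)) =
      goldCount e ((r + (s + t)) ^ (2 ^ e + 1) +
        (r ^ (2 ^ e + 1) + (s ^ (2 ^ e + 1) + t ^ (2 ^ e + 1)))) := by
    rw [column_add_column_add, columnCount_three]
  have h2 : r ∉ ({s, t} : Finset F) := by simp [hrs, hrt]
  rw [n0, n1, n1, n1, n2, n2, n2, n3] at h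
  rw [h, Finset.sum_insert h2, Finset.sum_pair hst, Finset.sum_insert h2, Finset.sum_pair hst]
  ring

-- With `α` fixed only the last two coordinates are averaged, and among subset sums of the columns
-- at `T` they vanish only for the empty subset.
include hF hT in
lemma four_mul_card_fiber (α : F) :
    4 * (((vanishing e T).filter fun p => p.1 = α).card : ℤ) = 2 ^ m := by
  have h1 : ∑ r : F × ZMod 2, (∑ S ∈ T.powerset, sgn (pairing (α, r) (∑ s ∈ S, column e s))) =
      2 * 2 ^ m := by
    rw [Finset.sum_comm]
    simp_rw [sum_sgn_pairing_snd hF]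
    obtain ⟨r, s, t, hrs, hrt, hst, rfl⟩ := Finset.card_eq_three.1 hT
    have n1 : ∀ x : F, (column e x).2 ≠ 0 := fun x => by simp [column]
    have n2 : ∀ x y : F, x ≠ y → (column e x + column e y).2 ≠ 0 := fun x y hxy => by
      simp [column, CharTwo.add_eq_zero, hxy]
    have n3 : (column e r + (column e s + column e t)).2 ≠ 0 := by
      intro h
      exact absurd (congrArg Prod.snd h) (show (1 + (1 + 1) : ZMod 2) ≠ 0 by decide)
    rw [sum_powerset_triple hrs hrt hst
      fun v => if v.2 = 0 then 2 * 2 ^ m * traceChar F (α * v.1) else 0]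
    rw [if_neg (n1 r), if_neg (n1 s), if_neg (n1 t), if_neg (n2 _ _ hrs), if_neg (n2 _ _ hrt),
      if_neg (n2 _ _ hst), if_neg n3]
    simp
  simp_rw [sum_powerset_sgn, hT] at h1
  have h2 : ((vanishing e T).filter fun p => p.1 = α).card =
      (Finset.univ.filter fun r : F × ZMod 2 => (α, r) ∈ vanishing e T).card := by
    refine (Finset.card_nbij (fun r => (α, r)) ?_ ?_ ?_).symm
    · intro r hr
      simpa using hr
    · intro r _ r' _ h
      exact congrArg Prod.snd h
    · rintro ⟨α', r⟩ hp
      simp only [Finset.coe_filter, Set.mem_ofPred_eq] at hp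
      obtain ⟨hp, rfl⟩ := hp
      exact ⟨r, by simpa using hp, rfl⟩
  rw [h2, Finset.card_filter]
  push_cast
  have h3 : ∀ r : F × ZMod 2, (if (α, r) ∈ vanishing e T then (2 : ℤ) ^ 3 else 0) =
      8 * if (α, r) ∈ vanishing e T then (1 : ℤ) else 0 := by
    intro r; split_ifs <;> norm_num
  simp_rw [h3] at h1
  rw [← Finset.mul_sum] at h1
  linarith

end Moments

/-! ### The frequencies of the character sums. -/

section Distribution

variable {F : Type*} [Field F] [Fintype F] [DecidableEq F] [Algebra (ZMod 2) F] {m e : ℕ}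

omit [DecidableEq F] in
lemma wordSum_sq (p : F × F × ZMod 2) : wordSum e p ^ 2 = walsh e p.1 p.2.1 ^ 2 := by
  rw [wordSum_eq, mul_pow, sq (sgn _), sgn_mul_self, one_mul]

omit [Fintype F] [DecidableEq F] in
lemma pairing_zero_left (v : F × F × ZMod 2) : pairing 0 v = 0 := by simp [pairing]

omit [Fintype F] [DecidableEq F] in
lemma pairing_add_left (p q v : F × F × ZMod 2) :
    pairing (p + q) v = pairing p v + pairing q v := by
  simp only [pairing, Prod.fst_add, Prod.snd_add, add_mul, map_add]
  ring

lemma zero_mem_vanishing (T : Finset F) : (0 : F × F × ZMod 2) ∈ vanishing e T := by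
  simp [vanishing, pairing_zero_left]

lemma add_mem_vanishing {T : Finset F} {p p' : F × F × ZMod 2} (hp : p ∈ vanishing e T)
    (hp' : p' ∈ vanishing e T) : p + p' ∈ vanishing e T := by
  simp only [vanishing, Finset.mem_filter, Finset.mem_univ, true_and] at hp hp' ⊢
  intro t ht
  rw [pairing_add_left, hp t ht, hp' t ht, add_zero]

omit [DecidableEq F] in
lemma wordSum_zero (hF : Fintype.card F = 2 ^ m) : wordSum e (0 : F × F × ZMod 2) = 2 ^ m := by
  simp [wordSum, pairing_zero_left, hF]

/-- The number of codewords vanishing on `T` with character sum `i`. -/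
def sumCount (e : ℕ) (T : Finset F) (i : ℤ) : ℕ :=
  ((vanishing e T).filter fun p => wordSum e p = i).card

/-- The nonzero elements of a field that are not cubes. -/
def nonCubes (F : Type*) [Field F] [Fintype F] [DecidableEq F] : Finset F :=
  (Finset.univ.erase 0) \ cubes F

omit [Algebra (ZMod 2) F] in
lemma mem_nonCubes {x : F} : x ∈ nonCubes F ↔ x ≠ 0 ∧ ¬ ShortenedCode.IsCubicResidue x := by
  simp [nonCubes, mem_cubes]

omit [Algebra (ZMod 2) F] in
lemma three_mul_card_nonCubes (hF : Fintype.card F = 2 ^ m) (hm2 : Even m) :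
    3 * ((nonCubes F).card : ℤ) = 2 * (2 ^ m - 1) := by
  have hsub : cubes F ⊆ Finset.univ.erase 0 := by
    intro x hx
    obtain ⟨z, hz, rfl⟩ := mem_cubes.1 hx
    simpa using hz
  have h1 := Finset.card_sdiff_add_card_eq_card hsub
  have h2 := Finset.card_erase_add_one (Finset.mem_univ (0 : F))
  rw [Finset.card_univ, hF] at h2
  have h3 := three_mul_card_cubes (F := F) hF hm2
  have h4 : ((nonCubes F).card : ℤ) + (cubes F).card + 1 = 2 ^ m := by
    have : (nonCubes F).card + (cubes F).card + 1 = 2 ^ m := by rw [nonCubes, h1, h2]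
    exact_mod_cast this
  linarith

variable [CharP F 2] (hF : Fintype.card F = 2 ^ m) (hm : m ≠ 0) (hm2 : Even m)
  (hme : m.Coprime e) {T : Finset F} {s : ℤ} (hs : s ^ 2 = 2 ^ m) (hs4 : 4 ≤ s)

include hF hm hm2 hme hs hs4

omit hs4 in
lemma wordSum_of_mem_nonCubes {p : F × F × ZMod 2} (hp : p.1 ∈ nonCubes F) :
    wordSum e p = s ∨ wordSum e p = -s := by
  obtain ⟨h0, h1⟩ := mem_nonCubes.1 hp
  rw [← sq_eq_sq_iff_eq_or_eq_neg, wordSum_sq, hs]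
  exact walsh_sq_of_not_isCubicResidue hF hm hm2 hme h0 h1 _

omit hs4 in
lemma wordSum_of_notMem_nonCubes (hT : T.Nonempty) {p : F × F × ZMod 2} (hpT : p ∈ vanishing e T)
    (hp0 : p ≠ 0) (hp : p.1 ∉ nonCubes F) :
    wordSum e p = 2 * s ∨ wordSum e p = 0 ∨ wordSum e p = -(2 * s) := by
  by_cases h0 : p.1 = 0
  · right; left
    rw [wordSum_eq, h0, walsh_zero_left hF, if_neg, mul_zero]
    intro h1
    apply hp0
    obtain ⟨t, ht⟩ := hT
    simp only [vanishing, Finset.mem_filter, Finset.mem_univ, true_and] at hpT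
    have h2 := hpT t ht
    rw [pairing, h0, h1] at h2
    simp only [zero_mul, add_zero, map_zero, zero_add, column, mul_one] at h2
    exact Prod.ext h0 (Prod.ext h1 h2)
  · rw [mem_nonCubes, not_and, not_not] at hp
    rcases walsh_sq_eq_of_isCubicResidue hF hm hm2 hme (hp h0) p.2.1 with h | h
    · rw [← wordSum_sq, sq_eq_zero_iff] at h
      exact Or.inr (Or.inl h)
    · rw [← wordSum_sq, ← hs, show 4 * s ^ 2 = (2 * s) ^ 2 by ring, sq_eq_sq_iff_eq_or_eq_neg] at h
      exact h.imp_right Or.inr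

omit hs4 in
lemma wordSum_mem (hT : T.Nonempty) {p : F × F × ZMod 2} (hpT : p ∈ vanishing e T) :
    wordSum e p ∈ ({2 ^ m, 2 * s, s, 0, -s, -(2 * s)} : Finset ℤ) := by
  simp only [Finset.mem_insert, Finset.mem_singleton]
  by_cases hp0 : p = 0
  · subst hp0
    exact Or.inl (wordSum_zero hF)
  · by_cases hp : p.1 ∈ nonCubes F
    · have := wordSum_of_mem_nonCubes hF hm hm2 hme hs hp
      tauto
    · have := wordSum_of_notMem_nonCubes hF hm hm2 hme hs hT hpT hp0 hp
      tauto

lemma wordSum_le (hT : T.Nonempty) {p : F × F × ZMod 2} (hpT : p ∈ vanishing e T)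
    (hp0 : p ≠ 0) : wordSum e p ≤ 2 * s := by
  by_cases hp : p.1 ∈ nonCubes F
  · have := wordSum_of_mem_nonCubes hF hm hm2 hme hs hp
    omega
  · have := wordSum_of_notMem_nonCubes hF hm hm2 hme hs hT hpT hp0 hp
    omega

/-- A nonzero word has sum at most `2 * s`, which is below `s ^ 2 = 2 ^ m` as `s ≥ 4`. -/
lemma wordSum_eq_two_pow_iff (hT : T.Nonempty) {p : F × F × ZMod 2} (hpT : p ∈ vanishing e T) :
    wordSum e p = 2 ^ m ↔ p = 0 := by
  constructor
  · intro h
    by_contra hp0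
    have := wordSum_le hF hm hm2 hme hs hs4 hT hpT hp0
    rw [h, ← hs] at this
    nlinarith
  · rintro rfl
    exact wordSum_zero hF

lemma sumCount_two_pow (hT : T.Nonempty) : sumCount e T (2 ^ m) = 1 := by
  rw [sumCount, Finset.card_eq_one]
  refine ⟨0, Finset.ext fun p => ?_⟩
  rw [Finset.mem_filter, Finset.mem_singleton]
  constructor
  · rintro ⟨h1, h2⟩
    exact (wordSum_eq_two_pow_iff hF hm hm2 hme hs hs4 hT h1).1 h2
  · rintro rfl
    exact ⟨zero_mem_vanishing T, wordSum_zero hF⟩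

lemma sum_wordSum_pow (hT : T.Nonempty) (k : ℕ) : ∑ p ∈ vanishing e T, wordSum e p ^ k =
    (2 ^ m) ^ k + sumCount e T (2 * s) * (2 * s) ^ k + sumCount e T s * s ^ k +
      sumCount e T 0 * 0 ^ k + sumCount e T (-s) * (-s) ^ k +
        sumCount e T (-(2 * s)) * (-(2 * s)) ^ k := by
  have hq : 2 * s < 2 ^ m := by rw [← hs]; nlinarith
  rw [← Finset.sum_fiberwise_of_maps_to
    (fun p hp => wordSum_mem hF hm hm2 hme hs hT hp) fun p => wordSum e p ^ k]
  have h : ∀ i : ℤ, ∑ p ∈ vanishing e T with wordSum e p = i, wordSum e p ^ k =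
      sumCount e T i * i ^ k := by
    intro i
    rw [sumCount, ← nsmul_eq_mul, ← Finset.sum_const]
    exact Finset.sum_congr rfl fun p hp => by rw [(Finset.mem_filter.1 hp).2]
  simp_rw [h]
  rw [Finset.sum_insert, Finset.sum_insert, Finset.sum_insert, Finset.sum_insert,
    Finset.sum_pair, sumCount_two_pow hF hm hm2 hme hs hs4 hT]
  · push_cast; ring
  all_goals
    simp only [Finset.mem_insert, Finset.mem_singleton, not_or, ne_eq]
    omega

/-- The values `±s` occur exactly when `α` is a noncube; there are `2 * (q - 1) / 3` noncubes, each
carrying `q / 4` words. -/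
lemma sumCount_add_sumCount_neg (hT : T.card = 3) :
    6 * ((sumCount e T s : ℤ) + sumCount e T (-s)) = 2 ^ m * (2 ^ m - 1) := by
  have hTn : T.Nonempty := Finset.card_pos.1 (by omega)
  have h1 : sumCount e T s + sumCount e T (-s) =
      ((vanishing e T).filter fun p => p.1 ∈ nonCubes F).card := by
    rw [sumCount, sumCount, ← Finset.card_union_of_disjoint]
    · congr 1
      ext p
      rw [← Finset.filter_or, Finset.mem_filter, Finset.mem_filter]
      refine and_congr_right fun hp => ⟨fun h => ?_, fun h =>
        wordSum_of_mem_nonCubes hF hm hm2 hme hs h⟩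
      by_contra hc
      by_cases hp0 : p = 0
      · subst hp0
        rw [wordSum_zero hF, ← hs] at h
        rcases h with h | h <;> nlinarith
      · have := wordSum_of_notMem_nonCubes hF hm hm2 hme hs hTn hp hp0 hc
        omega
    · rw [Finset.disjoint_filter]
      intro p _ h1 h2
      omega
  have h2 : 4 * (((vanishing e T).filter fun p => p.1 ∈ nonCubes F).card : ℤ) =
      (nonCubes F).card * 2 ^ m := by
    rw [Finset.card_eq_sum_card_fiberwise (f := Prod.fst) (t := nonCubes F)
      (s := (vanishing e T).filter fun p => p.1 ∈ nonCubes F)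
      (fun p hp => (Finset.mem_filter.1 hp).2)]
    push_cast
    rw [Finset.mul_sum, ← nsmul_eq_mul, ← Finset.sum_const]
    refine Finset.sum_congr rfl fun α hα => ?_
    rw [← four_mul_card_fiber (e := e) hF hT α, Finset.filter_filter]
    congr 2
    refine congrArg Finset.card (Finset.filter_congr fun p _ => ?_)
    exact ⟨And.right, fun h => ⟨h ▸ hα, h⟩⟩
  have h3 := three_mul_card_nonCubes (F := F) hF hm2
  rw [← h1] at h2
  push_cast at h2
  have h5 : 2 * (6 * ((sumCount e T s : ℤ) + sumCount e T (-s))) = 2 * (2 ^ m * (2 ^ m - 1)) := by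
    linear_combination 3 * h2 + 2 ^ m * h3
  exact mul_left_cancel₀ two_ne_zero h5

/-- The numbers of codewords with given character sums, in terms of the number `l` of supports. -/
lemma sumCount_formulas (hT : T.card = 3) {l : ℤ}
    (hl : (goldCount e ((∑ x ∈ T, x) ^ (2 ^ e + 1) + ∑ x ∈ T, x ^ (2 ^ e + 1)) : ℤ) =
      6 * (l + 1)) :
    96 * (sumCount e T (2 * s) : ℤ) = s * (8 + 8 * s + s ^ 3 + 4 * s ^ 2 + 12 * l) ∧
    24 * (sumCount e T s : ℤ) = s * ((2 + s) * (-8 + 3 * s + 2 * s ^ 2) - 6 * l) ∧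
    16 * (sumCount e T 0 : ℤ) = -16 + s ^ 4 ∧
    24 * (sumCount e T (-s) : ℤ) = s * ((-2 + s) * (-8 - 3 * s + 2 * s ^ 2) + 6 * l) ∧
    96 * (sumCount e T (-(2 * s)) : ℤ) = s * (-8 + 8 * s + s ^ 3 - 4 * s ^ 2 - 12 * l) := by
  have hTn : T.Nonempty := Finset.card_pos.1 (by omega)
  have key := sum_wordSum_pow hF hm hm2 hme (T := T) hs hs4 hTn
  have h0 := moment_zero (e := e) hF hT
  have h1 := moment_one hF hme hT
  have h2 := moment_two hF hme hT
  have h3 := moment_three hF hme hT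
  have h4 := sumCount_add_sumCount_neg hF hm hm2 hme hs hs4 hT
  have k0 := key 0
  have k1 := key 1
  simp only [pow_zero, Finset.sum_const, nsmul_eq_mul, mul_one] at k0
  simp only [pow_one] at k1
  rw [k0] at h0
  rw [k1] at h1
  rw [key 2] at h2
  rw [key 3, hl] at h3
  rw [← hs] at h0 h1 h2 h3 h4
  have hs0 : s ≠ 0 := by omega
  generalize (sumCount e T (2 * s) : ℤ) = c at *
  generalize (sumCount e T s : ℤ) = a at *
  generalize (sumCount e T 0 : ℤ) = z at *
  generalize (sumCount e T (-s) : ℤ) = b at *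
  generalize (sumCount e T (-(2 * s)) : ℤ) = d at *
  -- After `2 ^ m = s ^ 2`, the moment of order `k` is divisible by `s ^ k`. The cancelled
  -- equations, with `h0` and `h4`, are a linear system in the five frequencies.
  have e1 : 4 * (s + 2 * c + a - b - 2 * d) = 3 * s ^ 3 :=
    mul_left_cancel₀ hs0 (by linear_combination h1)
  have e2 : 4 * (s ^ 2 + 4 * c + a + b + 4 * d) = s ^ 2 * (s ^ 2 + 6) :=
    mul_left_cancel₀ (pow_ne_zero 2 hs0) (by linear_combination h2)
  have e3 : 4 * (s ^ 3 + 8 * c + a - b - 8 * d) = s * (9 * s ^ 2 + 6 * l) :=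
    mul_left_cancel₀ (pow_ne_zero 3 hs0) (by linear_combination h3)
  refine ⟨?_, ?_, ?_, ?_, ?_⟩ <;> linarith

end Distribution

/-! ### Passage to the shortened code. -/

section Code

variable {F : Type*} [Field F] [Fintype F] [DecidableEq F] [Algebra (ZMod 2) F] {m e : ℕ}

/-- The codeword with parameters `p`, with the coordinates in `T` deleted. -/
def shortWord (e : ℕ) (T : Finset F) (p : F × F × ZMod 2) : {i // i ∉ T} → ZMod 2 :=
  fun i => pairing p (column e (i : F))

omit [DecidableEq F] in
lemma mem_traceCode_iff (w : F → ZMod 2) :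
    w ∈ ShortenedCode.traceCode (ZMod 2) (X ^ (2 ^ e + 1) : F[X]) ↔
      ∃ p : F × F × ZMod 2, w = fun x => pairing p (column e x) := by
  constructor
  · rintro ⟨a, b, c, rfl⟩
    refine ⟨(a, b, Algebra.trace (ZMod 2) F c), ?_⟩
    ext x
    simp [pairing, column]
  · rintro ⟨⟨a, b, c⟩, rfl⟩
    obtain ⟨c', rfl⟩ := Algebra.trace_surjective (ZMod 2) F c
    refine ⟨a, b, c', ?_⟩
    ext x
    simp [pairing, column]

lemma mem_shortened_iff (T : Finset F) (c : {i // i ∉ T} → ZMod 2) :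
    c ∈ ShortenedCode.shortened (ShortenedCode.traceCode (ZMod 2) (X ^ (2 ^ e + 1) : F[X])) T ↔
      ∃ p ∈ vanishing e T, shortWord e T p = c := by
  constructor
  · rintro ⟨w, ⟨hw, hwT⟩, rfl⟩
    obtain ⟨p, rfl⟩ := (mem_traceCode_iff w).1 hw
    exact ⟨p, by simpa [vanishing] using hwT, rfl⟩
  · rintro ⟨p, hp, rfl⟩
    exact ⟨_, ⟨(mem_traceCode_iff _).2 ⟨p, rfl⟩, by simpa [vanishing] using hp⟩, rfl⟩

/-- Deleting `T` loses no weight because the word vanishes there; each zero contributes `1` to the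
character sum and each nonzero coordinate `-1`. -/
lemma wordSum_add_two_mul_hammingNorm (hF : Fintype.card F = 2 ^ m) {T : Finset F}
    {p : F × F × ZMod 2} (hp : p ∈ vanishing e T) :
    wordSum e p + 2 * (hammingNorm (shortWord e T p) : ℤ) = 2 ^ m := by
  have h1 : hammingNorm (shortWord e T p) =
      (Finset.univ.filter fun x : F => pairing p (column e x) ≠ 0).card := by
    rw [hammingNorm]
    refine Finset.card_nbij Subtype.val ?_ Subtype.val_injective.injOn ?_
    · intro i hi
      simp only [Finset.coe_filter, Finset.mem_univ, true_and, Set.mem_ofPred_eq] at hi ⊢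
      exact hi
    · intro x hx
      simp only [Finset.coe_filter, Finset.mem_univ, true_and, Set.mem_ofPred_eq] at hx
      have hxT : x ∉ T := by
        intro h
        simp only [vanishing, Finset.mem_filter, Finset.mem_univ, true_and] at hp
        exact hx (hp x h)
      refine ⟨⟨x, hxT⟩, ?_, rfl⟩
      simp only [Finset.coe_filter, Finset.mem_univ, true_and, Set.mem_ofPred_eq]
      exact hx
  rw [h1, Finset.card_filter, wordSum]
  push_cast
  rw [Finset.mul_sum, ← Finset.sum_add_distrib]
  have h2 : ∀ x : F, sgn (pairing p (column e x)) +
      2 * (if pairing p (column e x) ≠ 0 then (1 : ℤ) else 0) = 1 := by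
    intro x
    rw [sgn_apply]
    by_cases h : pairing p (column e x) = 0 <;> simp [h]
  simp_rw [h2]
  simp [hF]

variable [CharP F 2] (hF : Fintype.card F = 2 ^ m) (hm : m ≠ 0) (hm2 : Even m)
  (hme : m.Coprime e) {T : Finset F} {s : ℤ} (hs : s ^ 2 = 2 ^ m) (hs4 : 4 ≤ s)

include hF hm hm2 hme hs hs4

/-- If two words agree, their parameters sum to those of a word of weight `0`, whose character sum
is `2 ^ m`. -/
lemma shortWord_injOn (hT : T.Nonempty) :
    Set.InjOn (shortWord e T) (vanishing e T : Set (F × F × ZMod 2)) := by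
  intro p hp p' hp' h
  have hpp := add_mem_vanishing hp hp'
  have h0 : shortWord e T (p + p') = 0 := by
    ext i
    rw [shortWord, pairing_add_left]
    have hi := congrFun h i
    simp only [shortWord] at hi
    rw [hi, CharTwo.add_self_eq_zero]
    rfl
  have h1 := wordSum_add_two_mul_hammingNorm hF hpp
  rw [h0, hammingNorm_zero] at h1
  have h2 := (wordSum_eq_two_pow_iff hF hm hm2 hme hs hs4 hT hpp).1 (by simpa using h1)
  have h3 := congrArg Prod.fst h2
  have h4 := congrArg (fun v => v.2.1) h2
  have h5 := congrArg (fun v => v.2.2) h2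
  exact Prod.ext (CharTwo.add_eq_zero.1 h3) (Prod.ext (CharTwo.add_eq_zero.1 h4)
    (CharTwo.add_eq_zero.1 h5))

lemma weightCount_shortened (hT : T.Nonempty) (w : ℕ) :
    ShortenedCode.weightCount (ShortenedCode.shortened
      (ShortenedCode.traceCode (ZMod 2) (X ^ (2 ^ e + 1) : F[X])) T) w =
        sumCount e T (2 ^ m - 2 * w) := by
  have hset : {c : {i // i ∉ T} → ZMod 2 | c ∈ ShortenedCode.shortened
      (ShortenedCode.traceCode (ZMod 2) (X ^ (2 ^ e + 1) : F[X])) T ∧ hammingNorm c = w} =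
      shortWord e T '' ((vanishing e T).filter fun p => wordSum e p = 2 ^ m - 2 * w :
        Finset (F × F × ZMod 2)) := by
    ext c
    simp only [Set.mem_ofPred_eq, mem_shortened_iff, Set.mem_image, Finset.mem_coe,
      Finset.mem_filter]
    constructor
    · rintro ⟨⟨p, hp, rfl⟩, hw⟩
      have := wordSum_add_two_mul_hammingNorm hF hp
      exact ⟨p, ⟨hp, by rw [← hw]; linarith⟩, rfl⟩
    · rintro ⟨p, ⟨hp, hw⟩, rfl⟩
      have := wordSum_add_two_mul_hammingNorm hF hp
      exact ⟨⟨p, hp, rfl⟩, by omega⟩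
  rw [ShortenedCode.weightCount, hset, Set.InjOn.ncard_image, Set.ncard_coe_finset, sumCount]
  exact (shortWord_injOn hF hm hm2 hme hs hs4 hT).mono fun p hp => (Finset.mem_filter.1 hp).1

lemma finrank_shortened (hT : T.card = 3) :
    Module.finrank (ZMod 2) (ShortenedCode.shortened
      (ShortenedCode.traceCode (ZMod 2) (X ^ (2 ^ e + 1) : F[X])) T) = 2 * m - 2 := by
  have hTn : T.Nonempty := Finset.card_pos.1 (by omega)
  have hset : ((ShortenedCode.shortened
      (ShortenedCode.traceCode (ZMod 2) (X ^ (2 ^ e + 1) : F[X])) T : Submodule _ _) : Set _) =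
      shortWord e T '' (vanishing e T : Set (F × F × ZMod 2)) := by
    ext c
    rw [SetLike.mem_coe, mem_shortened_iff]
    simp
  have h1 : Nat.card (ShortenedCode.shortened
      (ShortenedCode.traceCode (ZMod 2) (X ^ (2 ^ e + 1) : F[X])) T) = (vanishing e T).card := by
    rw [← SetLike.coe_sort_coe, Nat.card_coe_set_eq, hset,
      Set.InjOn.ncard_image (shortWord_injOn hF hm hm2 hme hs hs4 hTn), Set.ncard_coe_finset]
  rw [Module.natCard_eq_pow_finrank (K := ZMod 2), Nat.card_zmod] at h1
  have h2 := moment_zero (e := e) hF hT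
  rw [← h1] at h2
  have h3 : 2 ^ (2 + Module.finrank (ZMod 2) (ShortenedCode.shortened
      (ShortenedCode.traceCode (ZMod 2) (X ^ (2 ^ e + 1) : F[X])) T)) = 2 ^ (m * 2) := by
    rw [pow_add, pow_mul]
    exact_mod_cast h2
  have h4 := Nat.pow_right_injective le_rfl h3
  omega

/-- Minimum weight corresponds to the largest character sum of a nonzero word, `2 * s`, which `hpos`
makes attained. -/
lemma isLinearCode_shortened (hT : T.card = 3) {d : ℕ} (hd : (2 * d : ℤ) = 2 ^ m - 2 * s)
    (hpos : 0 < sumCount e T (2 * s)) :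
    ShortenedCode.IsLinearCode (ShortenedCode.shortened
      (ShortenedCode.traceCode (ZMod 2) (X ^ (2 ^ e + 1) : F[X])) T) (2 ^ m - 3) (2 * m - 2) d := by
  have hTn : T.Nonempty := Finset.card_pos.1 (by omega)
  refine ⟨?_, finrank_shortened hF hm hm2 hme hs hs4 hT, ?_, ?_⟩
  · rw [Fintype.card_subtype, ← hF, ← hT, ← Finset.card_compl]
    congr 1
    ext x
    simp
  · obtain ⟨p, hp⟩ := Finset.card_pos.1 hpos
    obtain ⟨hp, hw⟩ := Finset.mem_filter.1 hp
    have h1 := wordSum_add_two_mul_hammingNorm hF hp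
    have hq : 2 * s < 2 ^ m := by rw [← hs]; nlinarith
    refine ⟨shortWord e T p, (mem_shortened_iff T _).2 ⟨p, hp, rfl⟩, 0, Submodule.zero_mem _, ?_, ?_⟩
    · intro h
      rw [h, hammingNorm_zero] at h1
      omega
    · rw [hammingDist_zero_right]
      omega
  · rintro j ⟨v, hv, w, hw, hvw, rfl⟩
    obtain ⟨p, hp, hpv⟩ := (mem_shortened_iff T _).1 (Submodule.sub_mem _ hw hv)
    have hp0 : p ≠ 0 := by
      rintro rfl
      apply hvw
      symm
      rw [← sub_eq_zero, ← hpv]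
      ext i
      simp [shortWord, pairing_zero_left]
    have h1 := wordSum_add_two_mul_hammingNorm hF hp
    have h2 := wordSum_le hF hm hm2 hme hs hs4 hTn hp hp0
    rw [hammingDist_eq_hammingNorm, neg_add_eq_sub, ← hpv]
    omega

end Code

end GoldCode

end

/-! ### The numerical weight table and the final assembly. -/

namespace GoldCode

/-- With `m = 2 * (j + 1)` and `t = 2 ^ j`, half of `s`, all halved and negative exponents become
polynomials in `t`. -/
lemma weightTable_eq (j : ℕ) (l : ℚ) {t : ℕ} (ht : t = 2 ^ j) :
    ShortenedCode.weightTable (2 * (j + 1)) l =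
      [ (0, 1),
        (2 * t ^ 2 - 2 * t, t / 48 * (8 + 16 * t + 8 * t ^ 3 + 16 * t ^ 2 + 12 * l)),
        (2 * t ^ 2 - t, t / 12 * ((2 + 2 * t) * (-8 + 6 * t + 8 * t ^ 2) - 6 * l)),
        (2 * t ^ 2, -1 + (t : ℚ) ^ 4),
        (2 * t ^ 2 + t, t / 12 * ((-2 + 2 * t) * (-8 - 6 * t + 8 * t ^ 2) + 6 * l)),
        (2 * t ^ 2 + 2 * t, t / 48 * (-8 + 16 * t + 8 * t ^ 3 - 16 * t ^ 2 - 12 * l)) ] := by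
  have i1 : 2 * (j + 1) / 2 = j + 1 := by omega
  have i2 : 2 * j / 2 = j := by omega
  have i3 : 2 * (j + 1) - 1 = 2 * j + 1 := by omega
  have i4 : 3 * (2 * (j + 1)) / 2 = 3 * j + 3 := by omega
  have i5 : 2 * (j + 1) - 2 = 2 * j := by omega
  have i6 : ((2 * (j + 1) : ℕ) : ℤ) / 2 - 5 = (j : ℤ) - 4 := by omega
  have i7 : ((2 * (j + 1) : ℕ) : ℤ) / 2 - 3 = (j : ℤ) - 2 := by omega
  have htq : (2 : ℚ) ^ j = t := by rw [ht]; push_cast; rfl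
  have d1 : 2 ^ (2 * j + 1) = 2 * t ^ 2 := by rw [ht]; ring
  have d2 : 2 ^ (j + 1) = 2 * t := by rw [ht]; ring
  have q1 : (2 : ℚ) ^ ((j : ℤ) - 4) = t / 16 := by
    rw [zpow_sub₀ two_ne_zero, zpow_natCast, htq]; norm_num
  have q2 : (2 : ℚ) ^ ((j : ℤ) - 2) = t / 4 := by
    rw [zpow_sub₀ two_ne_zero, zpow_natCast, htq]; norm_num
  have q3 : (2 : ℚ) ^ (3 + (j + 1)) = 16 * t := by rw [← htq]; ring
  have q4 : (2 : ℚ) ^ (3 * j + 3) = 8 * t ^ 3 := by rw [← htq]; ring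
  have q5 : (2 : ℚ) ^ (2 + 2 * (j + 1)) = 16 * t ^ 2 := by rw [← htq]; ring
  have q6 : (2 : ℚ) ^ (1 + 2 * (j + 1)) = 8 * t ^ 2 := by rw [← htq]; ring
  have q7 : (2 : ℚ) ^ (j + 1) = 2 * t := by rw [← htq]; ring
  have q8 : (4 : ℚ) ^ (2 * j) = t ^ 4 := by
    rw [← htq, show (4 : ℚ) = 2 ^ 2 by norm_num, ← pow_mul, ← pow_mul]
    congr 1
    ring
  have q9 : 1 / 3 * ((t : ℚ) / 16) = t / 48 := by ring
  have q10 : 1 / 3 * ((t : ℚ) / 4) = t / 12 := by ring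
  have q11 : 3 * (2 * (t : ℚ)) = 6 * t := by ring
  simp only [ShortenedCode.weightTable, i1, i2, i3, i4, i5, i6, i7, d1, d2, ← ht, q1, q2, q3, q4,
    q5, q6, q7, q8, q9, q10, q11]

/-- The weight table is realised by a code whose weights are governed by the counts `N`. -/
lemma hasWeightDistribution_weightTable {ι : Type*} [Fintype ι]
    (C : Submodule (ZMod 2) (ι → ZMod 2)) (N : ℤ → ℕ) (j : ℕ) (l : ℤ) {s : ℤ}
    (hs : s = 2 * 2 ^ j)
    (hN : ∀ w : ℕ, ShortenedCode.weightCount C w = N (s ^ 2 - 2 * w))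
    (h0 : N (s ^ 2) = 1)
    (hne : ∀ i, N i ≠ 0 → i ∈ ({s ^ 2, 2 * s, s, 0, -s, -(2 * s)} : Finset ℤ))
    (f1 : 96 * (N (2 * s) : ℤ) = s * (8 + 8 * s + s ^ 3 + 4 * s ^ 2 + 12 * l))
    (f2 : 24 * (N s : ℤ) = s * ((2 + s) * (-8 + 3 * s + 2 * s ^ 2) - 6 * l))
    (f3 : 16 * (N 0 : ℤ) = -16 + s ^ 4)
    (f4 : 24 * (N (-s) : ℤ) = s * ((-2 + s) * (-8 - 3 * s + 2 * s ^ 2) + 6 * l))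
    (f5 : 96 * (N (-(2 * s)) : ℤ) = s * (-8 + 8 * s + s ^ 3 - 4 * s ^ 2 - 12 * l)) :
    ShortenedCode.HasWeightDistribution C
      (ShortenedCode.weightTable (2 * (j + 1)) (l : ℚ)) := by
  have ht1 : 1 ≤ 2 ^ j := Nat.one_le_two_pow
  rw [ShortenedCode.HasWeightDistribution, weightTable_eq j l rfl]
  obtain ⟨t, ht⟩ : ∃ t, t = 2 ^ j := ⟨_, rfl⟩
  have hst : s = 2 * (t : ℤ) := by rw [hs, ht]; push_cast; rfl
  rw [← ht] at ht1 ⊢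
  clear hs ht
  subst hst
  have htt : 2 * t ≤ 2 * t ^ 2 := by nlinarith
  have c1 : ((2 * t ^ 2 - 2 * t : ℕ) : ℤ) = 2 * (t : ℤ) ^ 2 - 2 * t := by
    rw [Nat.cast_sub htt]; push_cast; ring
  have c2 : ((2 * t ^ 2 - t : ℕ) : ℤ) = 2 * (t : ℤ) ^ 2 - t := by
    rw [Nat.cast_sub (by omega)]; push_cast; ring
  have r1 : (2 * (t : ℤ)) ^ 2 - 2 * (2 * t ^ 2 - 2 * t : ℕ) = 2 * (2 * t) := by rw [c1]; ring
  have r2 : (2 * (t : ℤ)) ^ 2 - 2 * (2 * t ^ 2 - t : ℕ) = 2 * t := by rw [c2]; ring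
  have r3 : (2 * (t : ℤ)) ^ 2 - 2 * (2 * t ^ 2 : ℕ) = 0 := by push_cast; ring
  have r4 : (2 * (t : ℤ)) ^ 2 - 2 * (2 * t ^ 2 + t : ℕ) = -(2 * t) := by push_cast; ring
  have r5 : (2 * (t : ℤ)) ^ 2 - 2 * (2 * t ^ 2 + 2 * t : ℕ) = -(2 * (2 * t)) := by
    push_cast; ring
  constructor
  · have f1' := congrArg (Int.cast : ℤ → ℚ) f1
    have f2' := congrArg (Int.cast : ℤ → ℚ) f2
    have f3' := congrArg (Int.cast : ℤ → ℚ) f3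
    have f4' := congrArg (Int.cast : ℤ → ℚ) f4
    have f5' := congrArg (Int.cast : ℤ → ℚ) f5
    push_cast at f1' f2' f3' f4' f5'
    simp only [List.forall_mem_cons, hN, r1, r2, r3, r4, r5]
    refine ⟨?_, ?_, ?_, ?_, ?_, ?_, List.forall_mem_nil _⟩
    · rw [Nat.cast_zero, mul_zero, sub_zero, h0, Nat.cast_one]
    all_goals linarith
  · intro w hw
    simp only [List.forall_mem_cons] at hw
    obtain ⟨w1, w2, w3, w4, w5, w6, -⟩ := hw
    rw [hN]
    by_contra hc
    have h := hne _ hc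
    simp only [Finset.mem_insert, Finset.mem_singleton, mul_pow] at h
    rw [← Nat.cast_pow] at h
    -- With the square as an atom everything is linear: each admissible character sum gives back a
    -- listed weight.
    generalize t ^ 2 = u at *
    omega

end GoldCode

theorem mainTheorem2 (m e : ℕ) (hm : 4 ≤ m) (hm2 : Even m) (he : 0 < e) (hme : Nat.gcd m e = 1)
    (F : Type*) [Field F] [Fintype F] [DecidableEq F] [Algebra (ZMod 2) F]
    (hF : Fintype.card F = 2 ^ m)
    (C : Submodule (ZMod 2) (F → ZMod 2))
    (hC : C = ShortenedCode.traceCode (ZMod 2) (Polynomial.X ^ (2 ^ e + 1) : Polynomial F))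
    (T : Finset F) (hT : T.card = 3)
    (a b : F) (ha : a = ∑ x ∈ T, x) (hb : b = ∑ x ∈ T, x ^ (2 ^ e + 1))
    (l : ℕ) (hl : l = ShortenedCode.lam (ShortenedCode.dualCode C) T 6) :
    (¬ ShortenedCode.IsCubicResidue (a ^ (2 ^ e + 1) + b) →
        (l : ℚ) = 1 / 6 * (2 ^ m - 2 + (-1) ^ (m / 2) * 2 ^ (m / 2)) - 1) ∧
      (ShortenedCode.IsCubicResidue (a ^ (2 ^ e + 1) + b) →
        (l : ℚ) = 1 / 6 * (2 ^ m - 2 - (-1) ^ (m / 2) * 2 ^ (m / 2 + 1)) - 1) ∧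
      ShortenedCode.IsLinearCode (ShortenedCode.shortened C T)
        (2 ^ m - 3) (2 * m - 2) (2 ^ (m - 1) - 2 ^ (m / 2)) ∧
      ShortenedCode.HasWeightDistribution (ShortenedCode.shortened C T)
        (ShortenedCode.weightTable m (l : ℚ)) := by
  have : CharP F 2 := charP_of_injective_algebraMap (algebraMap (ZMod 2) F).injective 2
  have hm0 : m ≠ 0 := by omega
  have hTm : T ∈ GoldCode.tripleSet e a b := GoldCode.mem_tripleSet.2 ⟨hT, ha.symm, hb.symm⟩
  have hTn : T.Nonempty := Finset.card_pos.1 (by omega)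
  have hc : a ^ (2 ^ e + 1) + b ≠ 0 := by
    obtain ⟨r, s, t, hrs, hrt, hst, rfl⟩ := Finset.card_eq_three.1 hT
    rw [ha, hb, GoldCode.sum_triple hrs hrt hst, GoldCode.sum_triple hrs hrt hst]
    exact GoldCode.pow_add_sum_ne_zero hF hme hrs hrt hst
  have hlam := GoldCode.lam_add_one hF hme hTm
  rw [← hC, ← hl] at hlam
  have hG : (GoldCode.goldCount e (a ^ (2 ^ e + 1) + b) : ℤ) = 6 * ((l : ℤ) + 1) := by
    rw [GoldCode.goldCount_eq_six_mul hc, ← hlam]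
    push_cast
    ring
  have hW := GoldCode.goldCount_eq hF hme hc
  rw [hG] at hW
  have hs : ((2 : ℤ) ^ (m / 2)) ^ 2 = 2 ^ m := by
    rw [← pow_mul, Nat.div_mul_cancel hm2.two_dvd]
  have hs4 : (4 : ℤ) ≤ 2 ^ (m / 2) := by
    calc (4 : ℤ) = 2 ^ 2 := by norm_num
      _ ≤ 2 ^ (m / 2) := pow_le_pow_right₀ (by norm_num) (by omega)
  rw [ha, hb] at hG
  obtain ⟨f1, f2, f3, f4, f5⟩ := GoldCode.sumCount_formulas hF hm0 hm2 hme hs hs4 hT hG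
  have hwc := GoldCode.weightCount_shortened hF hm0 hm2 hme hs hs4 hTn
  have h0 := GoldCode.sumCount_two_pow hF hm0 hm2 hme hs hs4 hTn
  have hcode := GoldCode.isLinearCode_shortened hF hm0 hm2 hme hs hs4 hT
    (d := 2 ^ (m - 1) - 2 ^ (m / 2))
  rw [← hC] at hwc hcode
  refine ⟨fun h => ?_, fun h => ?_, ?_⟩
  · rw [GoldCode.walsh_zero_of_not_isCubicResidue hF hm0 hm2 hme hc h] at hW
    have hW' : (6 : ℚ) * (l + 1) = 2 ^ m - 2 + (-1) ^ (m / 2) * 2 ^ (m / 2) := by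
      exact_mod_cast hW
    linarith
  · rw [GoldCode.walsh_zero_of_isCubicResidue hF hm0 hm2 hme h] at hW
    have hW' : (6 : ℚ) * (l + 1) = 2 ^ m - 2 + -((-1) ^ (m / 2) * 2 ^ (m / 2 + 1)) := by
      exact_mod_cast hW
    linarith
  obtain ⟨j, hj⟩ : ∃ j, m = 2 * (j + 1) := by
    obtain ⟨k, rfl⟩ := hm2
    exact ⟨k - 1, by omega⟩
  have hsj : (2 : ℤ) ^ (m / 2) = 2 * 2 ^ j := by
    rw [show m / 2 = j + 1 by omega]; ring
  constructor
  · refine hcode ?_ ?_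
    · rw [Nat.cast_sub (Nat.pow_le_pow_right (by norm_num) (by omega))]
      obtain ⟨n, rfl⟩ : ∃ n, m = n + 1 := ⟨m - 1, by omega⟩
      push_cast
      ring
    -- The formula for the frequency of `2 * s` has only positive or nonnegative terms, so words of
    -- minimum weight exist.
    · have : 0 < 96 * (GoldCode.sumCount e T (2 * 2 ^ (m / 2)) : ℤ) := by rw [f1]; positivity
      omega
  · rw [← hs] at h0 hwc
    have h := GoldCode.hasWeightDistribution_weightTable (ShortenedCode.shortened C T)
      (GoldCode.sumCount e T) j l hsj hwc h0 ?_ f1 f2 f3 f4 f5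
    · rw [hj]
      exact_mod_cast h
    · intro i hi
      obtain ⟨p, hp⟩ := Finset.card_ne_zero.1 hi
      obtain ⟨hpT, rfl⟩ := Finset.mem_filter.1 hp
      rw [hs]
      exact GoldCode.wordSum_mem hF hm0 hm2 hme hs hTn hpT
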